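/- **Setting.** Let $n\ge 3$. A *half-edged stranded graph of rank $n$* (with colors) consists of finitely many pre-edges, each with a color in $\{0,\dots,n\}$, where a pre-edge of color $c$ has $n$ points, one for each pair $\{c,c'\}$, $c'\neq c$; of chords, which pair up all the points, each chord joining two points with the same color pair and belonging to different pre-edges; of edges and half-edges, such that each pre-edge carries either one stranded half-edge or one end of exactly one edge, an edge joining two pre-edges $d,d'$ of the same color by $n$ strands, from each point of $d$ to the point of $d'$ with the same color pair; and of a finite number of trivial discs. Its vertices are the classes of pre-edges connected through chords, and the discs. *Cutting* an edge $e$ replaces it by two half-edges; the result is $\mathcal G\vee e$. *Contracting* $e$ removes $e$ and its two pre-edges, joins the chords that ended there through the strands of $e$, and turns each strand of $e$ whose two end points are joined by a chord into a trivial disc; the result is $\mathcal G/e$. A *half-edged colored tensor graph of rank $n$* is a finite bipartite graph with exactly one edge or half-edge of each color $0,\dots,n$ at every vertex; its stranded structure has, at each vertex, one pre-edge of each color and one chord for each pair of colors. A *rank $n$ w-colored graph* $\mathfrak G$ is the equivalence class, up to adding and removing trivial discs (and isomorphism), of a stranded graph obtained from a half-edged colored tensor graph of rank $n$ by successive edge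 contractions; the elements of this class are its *representatives*. An edge is a *loop* if its two pre-edges are at the same vertex, a *bridge* if cutting it increases the number of connected components, and *regular* if it is neither. A spanning c-subgraph $A\Subset\mathcal G$ is obtained from $\mathcal G$ by cutting a set of edges. Let $V,E,k,f$ be the numbers of vertices, edges, connected components (discs counted in $V$ and $k$) and half-edges, and $\mathrm r=V-k$, $\mathrm n=E-\mathrm r$. Faces are the maximal curves formed by chords and edge strands; a face is external if it ends on half-edges and internal otherwise; $F_{\rm int}$ is the number of internal faces, each disc counting as one. $B^p$ is the number of $p$-bubbles: the connected components, summed over all sets $S$ of $p$ colors, of what remains after removing all pre-edges with colors outside $S$ and all chords and strands with color pairs not contained in $S$ (discs are not counted). The boundary graph has the half-edges as vertices and the external faces as edges; $C_\partial$ and $E_\partial$ are its numbers of connected components and of edges, and $F_\partial$ is its number of faces: the connected components, summed over all sets $T$ of three colors, of its subgraph formed by the vertices with color in $T$ and the edges with color pair in $T$. For rationals $\boldsymbol\alpha=(\alpha_3,\dots,\alpha_n)$ put $$\gamma_{n;\boldsymbol\alpha}=\tfrac{n(n-1)}2(V-E)+(n-1)F_{\rm int}-(2+(n-2)\alpha_3)B^3+\sum_{k=4}^n\big[(k-1)\alpha_{k-1}-(n-k+1)\alpha_k\big]B^k,$$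 $$\mathfrak T_{\mathcal G;\boldsymbol\alpha}=\sum_{A\Subset\mathcal G}(x-1)^{\mathrm r(\mathcal G)-\mathrm r(A)}(y-1)^{\mathrm n(A)}z^{\frac{(n-1)(n+2)}2k(A)-\gamma_{n;\boldsymbol\alpha}(A)}s^{C_\partial(A)}w^{F_\partial(A)}q^{E_\partial(A)}t^{f(A)},$$ a polynomial in $x,y,s,w,q,t$ and in rational powers of $z$ with integer coefficients. **Theorem.** Let $n\ge3$, let $\alpha_3,\dots,\alpha_n$ be positive rational numbers, let $\mathcal G$ be any representative of a rank $n$ w-colored graph, and let $e$ be an edge of $\mathcal G$. If $e$ is regular, then $$\mathfrak T_{\mathcal G;\boldsymbol\alpha}=\mathfrak T_{\mathcal G\vee e;\boldsymbol\alpha}+\mathfrak T_{\mathcal G/e;\boldsymbol\alpha}.$$ If $e$ is a bridge, then $$\mathfrak T_{\mathcal G\vee e;\boldsymbol\alpha}=z^{(n-1)(n+1)+n\alpha_n}\,s\,w^{\frac{n(n-1)}2}q^nt^2\;\mathfrak T_{\mathcal G/e;\boldsymbol\alpha}$$ and $$\mathfrak T_{\mathcal G;\boldsymbol\alpha}=\big[(x-1)z^{(n-1)(n+1)+n\alpha_n}\,s\,w^{\frac{n(n-1)}2}q^nt^2+1\big]\,\mathfrak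 T_{\mathcal G/e;\boldsymbol\alpha}.$$ -/

import Mathlib

open scoped Classical

universe u

/-- A half-edged stranded graph of rank `n` whose pre-edges, and the (half-)edges attached to them,
carry a color in `{0, …, n}`.

* A pre-edge of color `c` has exactly `n` points, one for each unordered pair `t = {c, c'}` of
  distinct colors that contains `c`; thus a point is a pair `(d, t)` as in `IsPoint` below.
* `chord t d` is the pre-edge at the other end of the chord that starts at the point `(d, t)`;
  chords join points with the same pair `t`. The value `chord t d` is meaningless when `(d, t)`
  is not a point.
* Every pre-edge carries either an edge or a half-edge: if `mate d ≠ d`, an edge joins the pre-edges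
  `d` and `mate d`, its `n` strands joining `(d, t)` to `(mate d, t)`; if `mate d = d`, a stranded
  half-edge is attached to `d`.
* The stranded vertices are the classes of pre-edges connected by chords (a stranded vertex is
  connected by definition), together with `discs` trivial disc vertices, each of which consists of
  a single closed chord. -/
structure StrandedGraph (n : ℕ) where
  PreEdge : Type u
  finite : Finite PreEdge
  color : PreEdge → Fin (n + 1)
  chord : Sym2 (Fin (n + 1)) → PreEdge → PreEdge
  chord_color : ∀ t d, color d ∈ t → ¬ t.IsDiag → color (chord t d) ∈ t
  chord_chord : ∀ t d, color d ∈ t → ¬ t.IsDiag → chord t (chord t d) = d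
  chord_ne : ∀ t d, color d ∈ t → ¬ t.IsDiag → chord t d ≠ d
  mate : PreEdge → PreEdge
  mate_mate : ∀ d, mate (mate d) = d
  mate_color : ∀ d, color (mate d) = color d
  discs : ℕ

namespace StrandedGraph

variable {n : ℕ} (G : StrandedGraph.{u} n)

/-- `(d, t)` is a point of the pre-edge `d`. -/
def IsPoint (d : G.PreEdge) (t : Sym2 (Fin (n + 1))) : Prop :=
  G.color d ∈ t ∧ ¬ t.IsDiag

/-- The points of all pre-edges. -/
def Point : Type u :=
  {p : G.PreEdge × Sym2 (Fin (n + 1)) // G.IsPoint p.1 p.2}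

/-- Edges, as unordered pairs of pre-edges. -/
def Edge : Type u :=
  {e : Sym2 G.PreEdge // ∃ d, G.mate d ≠ d ∧ e = s(d, G.mate d)}

/-- Stranded half-edges. -/
def HalfEdge : Type u :=
  {d : G.PreEdge // G.mate d = d}

instance : Finite G.PreEdge := G.finite

instance : Finite G.Edge := by
  unfold Edge; infer_instance

noncomputable instance : Fintype G.Edge := Fintype.ofFinite _

theorem mate_mem_edge (e : G.Edge) (d : G.PreEdge) : G.mate d ∈ e.1 ↔ d ∈ e.1 := by
  obtain ⟨_, a, ha, rfl⟩ := e
  simp only [Sym2.mem_iff]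
  constructor
  · rintro (h | h)
    · right; rw [← h, G.mate_mate]
    · left; rw [← G.mate_mate d, h, G.mate_mate]
  · rintro (rfl | rfl)
    · right; rfl
    · left; rw [G.mate_mate]

theorem mate_ne_of_mem_edge (e : G.Edge) {d : G.PreEdge} (hd : d ∈ e.1) : G.mate d ≠ d := by
  obtain ⟨_, a, ha, rfl⟩ := e
  rcases Sym2.mem_iff.1 hd with rfl | rfl
  · exact ha
  · rw [G.mate_mate]; exact ha.symm

theorem eq_or_eq_mate_of_mem_edge (e : G.Edge) {d d' : G.PreEdge} (hd : d ∈ e.1)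
    (hd' : d' ∈ e.1) : d' = d ∨ d' = G.mate d := by
  obtain ⟨_, a, ha, rfl⟩ := e
  rcases Sym2.mem_iff.1 hd with rfl | rfl
  · exact Sym2.mem_iff.1 hd'
  · rw [G.mate_mate]; exact (Sym2.mem_iff.1 hd').symm

/-! ### Cut and contraction -/

/-- Cut all the edges in `S`: each of them is replaced by two half-edges. -/
noncomputable def cutEdges (S : Set G.Edge) : StrandedGraph.{u} n where
  PreEdge := G.PreEdge
  finite := G.finite
  color := G.color
  chord := G.chord
  chord_color := G.chord_color
  chord_chord := G.chord_chord
  chord_ne := G.chord_ne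
  mate d := if ∃ e ∈ S, d ∈ e.1 then d else G.mate d
  mate_mate d := by
    by_cases h : ∃ e ∈ S, d ∈ e.1
    · simp [h]
    · have h' : ¬ ∃ e ∈ S, G.mate d ∈ e.1 := by
        simpa only [G.mate_mem_edge] using h
      rw [if_neg h, if_neg h', G.mate_mate]
  mate_color d := by
    split_ifs
    · rfl
    · exact G.mate_color d
  discs := G.discs

/-- The graph `G ∨ e` obtained by cutting the edge `e`. -/
noncomputable def cut (e : G.Edge) : StrandedGraph.{u} n := G.cutEdges {e}

/-- The spanning c-subgraph of `G` with edge set `A`: all other edges are cut. -/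
noncomputable def spanning (A : Set G.Edge) : StrandedGraph.{u} n := G.cutEdges Aᶜ

/-- The number of inner faces of an edge: the color pairs `t` such that the two points `(d, t)` and
`(mate d, t)` of the two pre-edges of `e` are joined by a chord. -/
noncomputable def inner (e : G.Edge) : ℕ :=
  Nat.card {t : Sym2 (Fin (n + 1)) //
    ∃ d ∈ e.1, G.IsPoint d t ∧ G.chord t d = G.mate d}

/-- The pre-edge at the other end of the chord at `(d, t)` after contraction of `e`: the old chord
if it does not end on `e`, and otherwise the old chord continued along the strand of `e` and the
chord at the other end of that strand. (The last alternative never occurs at a point.) -/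
noncomputable def contractChord (e : G.Edge) (t : Sym2 (Fin (n + 1)))
    (d : {d : G.PreEdge // d ∉ e.1}) : {d : G.PreEdge // d ∉ e.1} :=
  if h : G.chord t d.1 ∉ e.1 then ⟨G.chord t d.1, h⟩
  else if h' : G.chord t (G.mate (G.chord t d.1)) ∉ e.1 then
    ⟨G.chord t (G.mate (G.chord t d.1)), h'⟩
  else d

theorem contractChord_cases (e : G.Edge) (t : Sym2 (Fin (n + 1)))
    (d : {d : G.PreEdge // d ∉ e.1}) (hd : G.color d.1 ∈ t) (ht : ¬ t.IsDiag) :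
    (G.chord t d.1 ∉ e.1 ∧ (G.contractChord e t d).1 = G.chord t d.1) ∨
    (G.chord t d.1 ∈ e.1 ∧ G.chord t (G.mate (G.chord t d.1)) ∉ e.1 ∧
      (G.contractChord e t d).1 = G.chord t (G.mate (G.chord t d.1))) := by
  by_cases h : G.chord t d.1 ∈ e.1
  · right
    have hc : G.color (G.mate (G.chord t d.1)) ∈ t := by
      rw [G.mate_color]; exact G.chord_color t _ hd ht
    have h' : G.chord t (G.mate (G.chord t d.1)) ∉ e.1 := by
      intro h'
      rcases G.eq_or_eq_mate_of_mem_edge e h h' with h1 | h1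
      · have h2 := G.chord_chord t _ hc ht
        rw [h1, G.chord_chord t _ hd ht] at h2
        exact d.2 (h2 ▸ (G.mate_mem_edge e _).2 h)
      · exact G.chord_ne t _ hc ht h1
    exact ⟨h, h', by simp [contractChord, h, h']⟩
  · left
    exact ⟨h, by simp [contractChord, h]⟩

/-- The graph `G / e` obtained by (soft) contraction of the edge `e`, loop or not: the edge and its
two pre-edges are removed, the chords that ended on them are joined through the strands of `e`, and
every inner face of `e` becomes a trivial disc vertex. -/
noncomputable def contract (e : G.Edge) : StrandedGraph.{u} n where
  PreEdge := {d : G.PreEdge // d ∉ e.1}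
  finite := inferInstance
  color d := G.color d.1
  chord := G.contractChord e
  chord_color t d hd ht := by
    rcases G.contractChord_cases e t d hd ht with ⟨_, h⟩ | ⟨_, _, h⟩
    · rw [h]; exact G.chord_color t _ hd ht
    · rw [h]
      refine G.chord_color t _ ?_ ht
      rw [G.mate_color]; exact G.chord_color t _ hd ht
  chord_chord t d hd ht := by
    have hd' := G.chord_color t _ hd ht
    have hm : G.color (G.mate (G.chord t d.1)) ∈ t := by rw [G.mate_color]; exact hd'
    apply Subtype.ext
    rcases G.contractChord_cases e t d hd ht with ⟨h0, h⟩ | ⟨h0, h1, h⟩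
    · have hcol : G.color (G.contractChord e t d).1 ∈ t := by rw [h]; exact hd'
      rcases G.contractChord_cases e t (G.contractChord e t d) hcol ht with ⟨_, k⟩ | ⟨k0, _, _⟩
      · rw [k, h, G.chord_chord t _ hd ht]
      · rw [h, G.chord_chord t _ hd ht] at k0
        exact absurd k0 d.2
    · have hcol : G.color (G.contractChord e t d).1 ∈ t := by
        rw [h]; exact G.chord_color t _ hm ht
      rcases G.contractChord_cases e t (G.contractChord e t d) hcol ht with ⟨k0, _⟩ | ⟨_, _, k⟩
      · rw [h, G.chord_chord t _ hm ht] at k0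
        exact absurd ((G.mate_mem_edge e _).2 h0) k0
      · rw [k, h, G.chord_chord t _ hm ht, G.mate_mate, G.chord_chord t _ hd ht]
  chord_ne t d hd ht := by
    have hm : G.color (G.mate (G.chord t d.1)) ∈ t := by
      rw [G.mate_color]; exact G.chord_color t _ hd ht
    intro hh
    have hh' := congrArg Subtype.val hh
    rcases G.contractChord_cases e t d hd ht with ⟨_, h⟩ | ⟨h0, _, h⟩
    · rw [h] at hh'; exact G.chord_ne t _ hd ht hh'
    · rw [h] at hh'
      have h2 := G.chord_chord t _ hm ht
      rw [hh'] at h2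
      exact G.mate_ne_of_mem_edge e h0 h2.symm
  mate d := ⟨G.mate d.1, fun h => d.2 ((G.mate_mem_edge e _).1 h)⟩
  mate_mate d := Subtype.ext (G.mate_mate d.1)
  mate_color d := G.mate_color d.1
  discs := G.discs + G.inner e

/-! ### Numerical data -/

/-- The number `V` of vertices. -/
noncomputable def numVertices : ℕ :=
  Nat.card (Quot fun d d' : G.PreEdge => ∃ t, G.IsPoint d t ∧ d' = G.chord t d) + G.discs

/-- The number `E` of edges. -/
noncomputable def numEdges : ℕ := Nat.card G.Edge

/-- The number `f` of half-edges. -/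
noncomputable def numHalfEdges : ℕ := Nat.card G.HalfEdge

/-- The number `k` of connected components. -/
noncomputable def numComponents : ℕ :=
  Nat.card (Quot fun d d' : G.PreEdge =>
    (∃ t, G.IsPoint d t ∧ d' = G.chord t d) ∨ d' = G.mate d) + G.discs

/-- The rank `r = V - k`; one has `k ≤ V`. -/
noncomputable def rank : ℕ := G.numVertices - G.numComponents

/-- The nullity `E - r`; one has `r ≤ E`. -/
noncomputable def nullity : ℕ := G.numEdges - G.rank

/-- Faces, other than those of the discs: the maximal curves formed by chords and strands of
edges. -/
def Face : Type u :=
  Quot fun p p' : G.Point =>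
    p'.1.2 = p.1.2 ∧ (p'.1.1 = G.chord p.1.2 p.1.1 ∨ p'.1.1 = G.mate p.1.1)

/-- The face through a point. -/
def faceOf (p : G.Point) : G.Face := Quot.mk _ p

/-- A face is open (external) if it passes through a point of a half-edge. -/
def Face.IsOpen {G : StrandedGraph.{u} n} (F : G.Face) : Prop :=
  ∃ p : G.Point, G.faceOf p = F ∧ G.mate p.1.1 = p.1.1

/-- The number `F_int` of closed faces; each disc contributes one. -/
noncomputable def numIntFaces : ℕ := Nat.card {F : G.Face // ¬ F.IsOpen} + G.discs

/-- The number `B^p` of (open and closed) `p`-bubbles (`p ≥ 2`): for every set `S` of `p` colors,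
the connected components of what is left after removing all pre-edges with a color outside `S`, and
all chords and strands whose color pair is not contained in `S`. -/
noncomputable def numBubbles (p : ℕ) : ℕ :=
  ∑ S ∈ (Finset.univ : Finset (Fin (n + 1))).powersetCard p,
    Nat.card (Quot fun d d' : {d : G.PreEdge // G.color d ∈ S} =>
      (∃ t, G.IsPoint d.1 t ∧ (∀ c ∈ t, c ∈ S) ∧ d'.1 = G.chord t d.1) ∨ d'.1 = G.mate d.1)

/-- The boundary graph has the half-edges as vertices and the open faces as edges, an open face
joining the two half-edges at its ends. `BoundaryAdj t h h'` says that an open face with color pair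
`t` joins `h` and `h'`. -/
def BoundaryAdj (t : Sym2 (Fin (n + 1))) (h h' : G.HalfEdge) : Prop :=
  ∃ (ph : G.IsPoint h.1 t) (ph' : G.IsPoint h'.1 t),
    G.faceOf ⟨(h.1, t), ph⟩ = G.faceOf ⟨(h'.1, t), ph'⟩

/-- The number `C_∂` of connected components of the boundary graph. -/
noncomputable def numBdryComponents : ℕ :=
  Nat.card (Quot fun h h' : G.HalfEdge => ∃ t, G.BoundaryAdj t h h')

/-- The number `E_∂` of edges of the boundary graph. -/
noncomputable def numBdryEdges : ℕ := Nat.card {F : G.Face // F.IsOpen}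

/-- The number `F_∂` of faces of the boundary graph: for every set `T` of three colors, the connected
components (cycles) of the subgraph of the boundary graph with the vertices whose color is in `T`
and the edges whose color pair is contained in `T`. -/
noncomputable def numBdryFaces : ℕ :=
  ∑ T ∈ (Finset.univ : Finset (Fin (n + 1))).powersetCard 3,
    Nat.card (Quot fun h h' : {h : G.HalfEdge // G.color h.1 ∈ T} =>
      ∃ t, (∀ c ∈ t, c ∈ T) ∧ G.BoundaryAdj t h.1 h'.1)

/-! ### Special edges -/

/-- A loop: both ends are on the same vertex. -/
def IsLoop (e : G.Edge) : Prop :=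
  ∀ d ∈ e.1, Relation.EqvGen (fun d d' : G.PreEdge => ∃ t, G.IsPoint d t ∧ d' = G.chord t d)
    d (G.mate d)

/-- A bridge: cutting it increases the number of connected components. -/
def IsBridge (e : G.Edge) : Prop := G.numComponents < (G.cut e).numComponents

/-- A regular edge is neither a loop nor a bridge. -/
def IsRegular (e : G.Edge) : Prop := ¬ G.IsLoop e ∧ ¬ G.IsBridge e

/-! ### Equivalence up to trivial discs -/

/-- Two stranded graphs are equivalent up to trivial discs if they are the same (isomorphic)
after removing all disc vertices. -/
def DiscEquiv (G H : StrandedGraph.{u} n) : Prop :=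
  ∃ φ : G.PreEdge ≃ H.PreEdge, (∀ d, H.color (φ d) = G.color d) ∧
    (∀ d, H.mate (φ d) = φ (G.mate d)) ∧
    ∀ t d, G.IsPoint d t → H.chord t (φ d) = φ (G.chord t d)

instance discSetoid (n : ℕ) : Setoid (StrandedGraph.{u} n) where
  r := DiscEquiv
  iseqv :=
    { refl := fun G => ⟨Equiv.refl _, by simp, by simp, by simp⟩
      symm := by
        rintro G H ⟨φ, h1, h2, h3⟩
        refine ⟨φ.symm, fun d => ?_, fun d => ?_, fun t d hd => ?_⟩
        · rw [← h1, φ.apply_symm_apply]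
        · apply φ.injective
          rw [← h2, φ.apply_symm_apply, φ.apply_symm_apply]
        · apply φ.injective
          have hd' : G.IsPoint (φ.symm d) t := by
            refine ⟨?_, hd.2⟩
            rw [← h1, φ.apply_symm_apply]; exact hd.1
          rw [← h3 t _ hd', φ.apply_symm_apply, φ.apply_symm_apply]
      trans := by
        rintro G H K ⟨φ, h1, h2, h3⟩ ⟨ψ, k1, k2, k3⟩
        refine ⟨φ.trans ψ, fun d => ?_, fun d => ?_, fun t d hd => ?_⟩
        · simp [h1, k1]
        · simp [h2, k2]
        · have hd' : H.IsPoint (φ d) t := ⟨by rw [h1]; exact hd.1, hd.2⟩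
          simp [k3 t _ hd', h3 t d hd] }

/-- `G.ContractsTo H`: `H` is obtained from `G` by successive edge contractions. -/
def ContractsTo : StrandedGraph.{u} n → StrandedGraph.{u} n → Prop :=
  Relation.ReflTransGen fun G H => ∃ e : G.Edge, H = G.contract e

end StrandedGraph

/-- A half-edged colored tensor graph of rank `n`, in compact form: a finite bipartite graph (with
parts given by `sign`) such that at each vertex and for each of the `n + 1` colors there is exactly
one edge or half-edge of that color. The edge of color `c` at `v` goes to `nbr c v`; if
`nbr c v = v`, there is a half-edge of color `c` at `v` instead. -/
structure ColoredTensorGraph (n : ℕ) where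
  Vertex : Type u
  finite : Finite Vertex
  sign : Vertex → Bool
  nbr : Fin (n + 1) → Vertex → Vertex
  nbr_nbr : ∀ c v, nbr c (nbr c v) = v
  sign_nbr : ∀ c v, nbr c v ≠ v → sign (nbr c v) ≠ sign v

/-- The stranded structure of a colored tensor graph: each vertex has one pre-edge of each color,
and for each pair of colors one chord joining the two pre-edges with these colors (its merged point
graph is the complete graph on `n + 1` points). -/
def ColoredTensorGraph.toStranded {n : ℕ} (K : ColoredTensorGraph.{u} n) :
    StrandedGraph.{u} n where
  PreEdge := K.Vertex × Fin (n + 1)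
  finite := by
    have := K.finite
    infer_instance
  color d := d.2
  chord t d := (d.1, if h : d.2 ∈ t then Sym2.Mem.other' h else d.2)
  chord_color t d hd _ := by
    simp only [dif_pos hd]
    exact Sym2.other_mem' hd
  chord_chord t d hd _ := by
    have h2 : Sym2.Mem.other' hd ∈ t := Sym2.other_mem' hd
    simp only [dif_pos hd, dif_pos h2, Sym2.other_invol' hd h2]
  chord_ne t d hd ht := by
    simp only [dif_pos hd, ne_eq, Prod.ext_iff, true_and]
    rw [← Sym2.other_eq_other']
    exact Sym2.other_ne ht hd
  mate d := (K.nbr d.2 d.1, d.2)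
  mate_mate d := by simp [K.nbr_nbr]
  mate_color d := rfl
  discs := 0

/-- A rank `n` w-colored graph: the equivalence class up to trivial discs of a stranded graph that is
obtained by successive edge contractions from a half-edged colored tensor graph of rank `n`. -/
structure WColoredGraph (n : ℕ) where
  toClass : Quotient (StrandedGraph.discSetoid.{u} n)
  exists_contraction : ∃ (K : ColoredTensorGraph.{u} n) (H : StrandedGraph.{u} n),
    K.toStranded.ContractsTo H ∧ toClass = Quotient.mk _ H

/-- `G` is a representative of the w-colored graph `W`. -/
def WColoredGraph.IsRepresentative {n : ℕ} (W : WColoredGraph.{u} n) (G : StrandedGraph.{u} n) :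
    Prop :=
  Quotient.mk _ G = W.toClass

/-! ### The polynomial -/

/-- The variables other than `z`. -/
inductive TVar : Type
  | x | y | s | w | q | t

/-- Polynomials in `x, y, s, w, q, t` and in rational powers of `z`, with integer coefficients. -/
abbrev TPoly : Type := AddMonoidAlgebra (MvPolynomial TVar ℤ) ℚ

/-- A variable other than `z`. -/
noncomputable def tvar (v : TVar) : TPoly := AddMonoidAlgebra.single 0 (MvPolynomial.X v)

/-- The power `z ^ r`. -/
noncomputable def zRatPow (r : ℚ) : TPoly := AddMonoidAlgebra.single r 1

/-- The generalized Euler characteristic `γ_{n;α}`. -/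
noncomputable def StrandedGraph.gamma {n : ℕ} (α : ℕ → ℚ) (G : StrandedGraph.{u} n) : ℚ :=
  (n : ℚ) * ((n : ℚ) - 1) / 2 * ((G.numVertices : ℚ) - (G.numEdges : ℚ))
    + ((n : ℚ) - 1) * (G.numIntFaces : ℚ)
    - (2 + ((n : ℚ) - 2) * α 3) * (G.numBubbles 3 : ℚ)
    + ∑ k ∈ Finset.Icc 4 n,
        (((k : ℚ) - 1) * α (k - 1) - ((n : ℚ) - (k : ℚ) + 1) * α k) * (G.numBubbles k : ℚ)

/-- The polynomial `𝔗_{G;α}(x,y,z,s,w,q,t)`, a sum over all spanning c-subgraphs `A` of `G`. -/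
noncomputable def StrandedGraph.invariant {n : ℕ} (α : ℕ → ℚ) (G : StrandedGraph.{u} n) : TPoly :=
  ∑ A : Finset G.Edge,
    (tvar .x - 1) ^ (G.rank - (G.spanning A).rank)
    * (tvar .y - 1) ^ (G.spanning A).nullity
    * zRatPow (((n : ℚ) - 1) * ((n : ℚ) + 2) / 2 * ((G.spanning A).numComponents : ℚ)
        - (G.spanning A).gamma α)
    * tvar .s ^ (G.spanning A).numBdryComponents
    * tvar .w ^ (G.spanning A).numBdryFaces
    * tvar .q ^ (G.spanning A).numBdryEdges
    * tvar .t ^ (G.spanning A).numHalfEdges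

/-!
Everything rests on one property of representatives of w-colored graphs: their pre-edges carry
signs (`StrandedGraph.IsOrientation`) that an edge reverses, while a chord reverses them exactly if
its two ends have the same color. The pre-edges at a vertex of a colored tensor graph take the sign
of that vertex in the bipartition; contractions and cuts preserve such signs. As a consequence a
pre-edge never separates its vertex, nor its bubble inside a vertex, nor does a half-edge separate
its component of the boundary graph: for a union of components of the rest, the signed numbers of
elements of two colors other than the color `c` of the removed element agree, and comparing them
with the signed number for `c` shows that the links at the removed element lead to this union either
for all color pairs or for none (`mem_of_balanced`).

Hence contracting an edge `e` that joins two different vertices merges them into one vertex, and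
bubbles, components, faces and the boundary graph keep their numbers; only `V` and `E` drop by one,
so that no exponent changes (`Orientable.term_contract`). If `e` is a bridge, then cutting it instead
of contracting it adds one component, `n.choose (p - 1)` bubbles for `p` colors, two half-edges, one
component, `n` edges and `n.choose 2` faces of the boundary graph, and no closed face: each face along
a strand of the bridge is open, again by counting signs. The coefficients of `γ` telescope over these
numbers of bubbles, which gives the constant factor of `Orientable.term_cut`.

A spanning subgraph of `G` that does not contain `e` is one of `G ∨ e`, and contraction of `e` is a
bijection from those that contain `e` to the spanning subgraphs of `G / e`; summing the terms gives
both recursions.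
-/

/-! ### Counting classes of generated equivalence relations -/

theorem Quot.mk_eq_of_map {X Y : Type*} {r : X → X → Prop} {r' : Y → Y → Prop} (f : X → Y)
    (h : ∀ a b, r a b → Quot.mk r' (f a) = Quot.mk r' (f b)) {a b : X}
    (hab : Quot.mk r a = Quot.mk r b) : Quot.mk r' (f a) = Quot.mk r' (f b) :=
  congrArg (Quot.lift (fun a => Quot.mk r' (f a)) h) hab

theorem Quot.apply_eq_of_mk_eq {X Y : Type*} {r : X → X → Prop} (f : X → Y)
    (h : ∀ a b, r a b → f a = f b) {a b : X} (hab : Quot.mk r a = Quot.mk r b) : f a = f b :=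
  congrArg (Quot.lift f h) hab

/-- Two relations have equally many classes if there are maps in both directions that respect the
relations and are mutually inverse up to the relations. -/
theorem Quot.card_eq_of_retract {X Y : Type*} {r : X → X → Prop} {r' : Y → Y → Prop}
    (f : X → Y) (g : Y → X)
    (hf : ∀ a b, r a b → Quot.mk r' (f a) = Quot.mk r' (f b))
    (hg : ∀ a b, r' a b → Quot.mk r (g a) = Quot.mk r (g b))
    (hgf : ∀ a, Quot.mk r (g (f a)) = Quot.mk r a)
    (hfg : ∀ a, Quot.mk r' (f (g a)) = Quot.mk r' a) :
    Nat.card (Quot r) = Nat.card (Quot r') :=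
  Nat.card_congr
    { toFun := Quot.lift (fun a => Quot.mk r' (f a)) hf
      invFun := Quot.lift (fun a => Quot.mk r (g a)) hg
      left_inv := by rintro ⟨a⟩; exact hgf a
      right_inv := by rintro ⟨a⟩; exact hfg a }

section Glue

variable {X I : Type*} {r r' : X → X → Prop} {a b : I → X}

/-- The map on the classes of `r` that sends the class of `b i` to the class of `a i` and fixes
all other classes. -/
noncomputable def glueRep (r : X → X → Prop) (a b : I → X) (q : Quot r) : Quot r :=
  if h : ∃ i, q = Quot.mk r (b i) then Quot.mk r (a h.choose) else q

theorem glueRep_left (hba : ∀ i j, Quot.mk r (b i) ≠ Quot.mk r (a j)) (i : I) :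
    glueRep r a b (Quot.mk r (a i)) = Quot.mk r (a i) :=
  dif_neg fun ⟨j, hj⟩ => hba j i hj.symm

theorem glueRep_right (hb : ∀ i j, Quot.mk r (b i) = Quot.mk r (b j) → i = j) (i : I) :
    glueRep r a b (Quot.mk r (b i)) = Quot.mk r (a i) := by
  have h : ∃ j, Quot.mk r (b i) = Quot.mk r (b j) := ⟨i, rfl⟩
  rw [glueRep, dif_pos h, ← hb _ _ h.choose_spec]

/-- If `r'` is generated by `r` and the pairs `(a i, b i)`, then two elements are `r'`-equivalent
iff the representatives of their `r`-classes agree. -/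
theorem glueRep_eq
    (hr' : ∀ x y, r' x y → Quot.mk r x = Quot.mk r y ∨
      ∃ i, (x = a i ∧ y = b i) ∨ (x = b i ∧ y = a i))
    (hba : ∀ i j, Quot.mk r (b i) ≠ Quot.mk r (a j))
    (hb : ∀ i j, Quot.mk r (b i) = Quot.mk r (b j) → i = j) {x y : X}
    (hxy : Quot.mk r' x = Quot.mk r' y) :
    glueRep r a b (Quot.mk r x) = glueRep r a b (Quot.mk r y) := by
  refine Quot.apply_eq_of_mk_eq (fun x => glueRep r a b (Quot.mk r x)) (fun x y h => ?_) hxy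
  rcases hr' x y h with h | ⟨i, ⟨rfl, rfl⟩ | ⟨rfl, rfl⟩⟩
  · simp only [h]
  · simp only [glueRep_left hba, glueRep_right hb]
  · simp only [glueRep_left hba, glueRep_right hb]

theorem glueRep_cases (q : Quot r) :
    (glueRep r a b q = q ∧ ∀ i, q ≠ Quot.mk r (b i)) ∨
      ∃ i, q = Quot.mk r (b i) ∧ glueRep r a b q = Quot.mk r (a i) := by
  by_cases h : ∃ i, q = Quot.mk r (b i)
  · exact Or.inr ⟨h.choose, h.choose_spec, dif_pos h⟩
  · exact Or.inl ⟨dif_neg h, fun i hi => h ⟨i, hi⟩⟩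

theorem mk_eq_or_of_glue
    (hr' : ∀ x y, r' x y → Quot.mk r x = Quot.mk r y ∨
      ∃ i, (x = a i ∧ y = b i) ∨ (x = b i ∧ y = a i))
    (hba : ∀ i j, Quot.mk r (b i) ≠ Quot.mk r (a j))
    (ha : ∀ i j, Quot.mk r (a i) = Quot.mk r (a j) → i = j)
    (hb : ∀ i j, Quot.mk r (b i) = Quot.mk r (b j) → i = j) {x y : X}
    (hxy : Quot.mk r' x = Quot.mk r' y) :
    Quot.mk r x = Quot.mk r y ∨ ∃ i,
      (Quot.mk r x = Quot.mk r (a i) ∧ Quot.mk r y = Quot.mk r (b i)) ∨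
      (Quot.mk r x = Quot.mk r (b i) ∧ Quot.mk r y = Quot.mk r (a i)) := by
  have h := glueRep_eq hr' hba hb hxy
  rcases glueRep_cases (a := a) (b := b) (Quot.mk r x) with ⟨hx, _⟩ | ⟨i, hx, hx'⟩ <;>
    rcases glueRep_cases (a := a) (b := b) (Quot.mk r y) with ⟨hy, _⟩ | ⟨j, hy, hy'⟩
  · rw [hx, hy] at h; exact Or.inl h
  · rw [hx, hy'] at h; exact Or.inr ⟨j, Or.inl ⟨h, hy⟩⟩
  · rw [hx', hy] at h; exact Or.inr ⟨i, Or.inr ⟨hx, h.symm⟩⟩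
  · rw [hx', hy'] at h
    rw [ha _ _ h] at hx
    exact Or.inl (hx.trans hy.symm)

/-- Gluing the classes of `b i` to those of `a i` lowers the number of classes by the number of
indices, provided that the classes of the `b i` are distinct and differ from those of the
`a j`. -/
theorem Quot.card_glue [Finite X] [Finite I]
    (hr : ∀ x y, r x y → Quot.mk r' x = Quot.mk r' y)
    (hab : ∀ i, Quot.mk r' (a i) = Quot.mk r' (b i))
    (hr' : ∀ x y, r' x y → Quot.mk r x = Quot.mk r y ∨
      ∃ i, (x = a i ∧ y = b i) ∨ (x = b i ∧ y = a i))
    (hba : ∀ i j, Quot.mk r (b i) ≠ Quot.mk r (a j))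
    (hb : ∀ i j, Quot.mk r (b i) = Quot.mk r (b j) → i = j) :
    Nat.card (Quot r) = Nat.card (Quot r') + Nat.card I := by
  rw [← Nat.card_sum]
  symm
  have hlift : ∀ q : Quot r, Quot.lift (fun x => Quot.mk r' x) hr (glueRep r a b q) =
      Quot.lift (fun x => Quot.mk r' x) hr q := by
    intro q
    rcases glueRep_cases (a := a) (b := b) q with ⟨h, _⟩ | ⟨i, h, h'⟩
    · rw [h]
    · rw [h', h]; exact hab i
  refine Nat.card_congr (Equiv.ofBijective (Sum.elim
    (Quot.lift (fun x => glueRep r a b (Quot.mk r x))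
      fun x y h => glueRep_eq hr' hba hb (Quot.sound h))
    fun i => Quot.mk r (b i)) ⟨?_, ?_⟩)
  · have key : ∀ q i, glueRep r a b q ≠ Quot.mk r (b i) := by
      intro q i h
      rcases glueRep_cases (a := a) (b := b) q with ⟨h1, h2⟩ | ⟨j, _, h2⟩
      · exact h2 i (h1.symm.trans h)
      · exact hba i j (h.symm.trans h2)
    rintro (p | i) (q | j) h
    · obtain ⟨x, rfl⟩ := Quot.exists_rep p
      obtain ⟨y, rfl⟩ := Quot.exists_rep q
      have h' : glueRep r a b (Quot.mk r x) = glueRep r a b (Quot.mk r y) := h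
      have := congrArg (Quot.lift (fun x => Quot.mk r' x) hr) h'
      rw [hlift, hlift] at this
      exact congrArg Sum.inl this
    · obtain ⟨x, rfl⟩ := Quot.exists_rep p
      exact absurd h (key _ j)
    · obtain ⟨y, rfl⟩ := Quot.exists_rep q
      exact absurd h.symm (key _ i)
    · exact congrArg Sum.inr (hb i j h)
  · rintro q
    rcases glueRep_cases (a := a) (b := b) q with ⟨h, _⟩ | ⟨i, h, _⟩
    · obtain ⟨x, rfl⟩ := Quot.exists_rep q
      exact ⟨Sum.inl (Quot.mk r' x), h⟩
    · exact ⟨Sum.inr i, h.symm⟩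

end Glue

/-! ### Signed links -/

/-- The sum of the signs of the elements of `Z` that have color `a`. -/
noncomputable def signedCount {X C : Type*} [Fintype X] (col : X → C) (σ : X → ℤ) (Z : Set X)
    (a : C) : ℤ :=
  ∑ x, (Z ∩ {x | col x = a}).indicator σ x

/-- Links of type `{a, b}` are balanced if every set that is a union of classes of linked elements
has the same signed number of elements of color `a` and of color `b`. If `x` of color `c` is
removed, a union `P` of components of the rest has equal signed numbers for all colors other than
`c`, and the signed number for `c` differs from the one for `b` exactly if the links of type
`{c, b}` at `x` lead to `P`. So either all links at `x` lead to `P` or none does. -/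
theorem mem_of_balanced {X C : Type*} [Fintype X] (col : X → C) (σ : X → ℤ)
    (R : Sym2 C → X → X → Prop) (symm : ∀ t x y, R t x y → R t y x)
    (trans : ∀ t x y z, R t x y → R t y z → R t x z)
    (hcol : ∀ t x y, R t x y → col y ∈ t)
    (bal : ∀ a b, a ≠ b → ∀ Z : Set X, (∀ x ∈ Z, ∀ y, R s(a, b) x y → y ∈ Z) →
      signedCount col σ Z a = signedCount col σ Z b)
    (S : Finset C) (P : Set X) {d : X} (hσ : σ d ≠ 0) (hd : d ∉ P)
    (hP : ∀ t, ¬ t.IsDiag → (∀ c ∈ t, c ∈ S) → ∀ x ∈ P, ∀ y, y ≠ d → R t x y → y ∈ P)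
    {t t' : Sym2 C} (ht : ¬ t.IsDiag) (ht' : ¬ t'.IsDiag) (htS : ∀ c ∈ t, c ∈ S)
    (htS' : ∀ c ∈ t', c ∈ S) {x y : X} (hx : x ∈ P) (hxd : R t x d) (hdy : R t' d y)
    (hy : y ≠ d) : y ∈ P := by
  by_contra hyP
  obtain ⟨b, rfl⟩ := hcol _ _ _ hxd
  obtain ⟨b', rfl⟩ := hcol _ _ _ (symm _ _ _ hdy)
  rw [Sym2.mk_isDiag_iff] at ht ht'
  have h1 : signedCount col σ (insert d P) (col d) = signedCount col σ (insert d P) b := by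
    refine bal _ _ ht _ ?_
    rintro z (rfl | hz) w hw
    · by_cases hwz : w = z
      · exact Or.inl hwz
      · exact Or.inr (hP _ (by simpa using ht) htS _ hx _ hwz (trans _ _ _ _ hxd hw))
    · by_cases hwd : w = d
      · exact Or.inl hwd
      · exact Or.inr (hP _ (by simpa using ht) htS _ hz _ hwd hw)
  have h2 : signedCount col σ P (col d) = signedCount col σ P b' := by
    refine bal _ _ ht' _ ?_
    intro z hz w hw
    have hwd : w ≠ d := by
      rintro rfl
      exact hyP (hP _ (by simpa using ht') htS' _ hz _ hy (trans _ _ _ _ hw hdy))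
    exact hP _ (by simpa using ht') htS' _ hz _ hwd hw
  have h3 : signedCount col σ P b = signedCount col σ P b' := by
    by_cases hbb : b = b'
    · rw [hbb]
    refine bal _ _ hbb _ ?_
    intro z hz w hw
    have hwd : w ≠ d := by
      rintro rfl
      rcases Sym2.mem_iff.1 (hcol _ _ _ hw) with h | h
      · exact ht h
      · exact ht' h
    refine hP _ (by simpa using hbb) ?_ _ hz _ hwd hw
    intro c hc
    rcases Sym2.mem_iff.1 hc with rfl | rfl
    · exact htS _ (Sym2.mem_mk_right _ _)
    · exact htS' _ (Sym2.mem_mk_right _ _)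
  have h4 : signedCount col σ (insert d P) (col d) = signedCount col σ P (col d) + σ d := by
    unfold signedCount
    rw [← sub_eq_iff_eq_add', ← Finset.sum_sub_distrib,
      Finset.sum_eq_single_of_mem d (Finset.mem_univ d)]
    · simp [Set.indicator, hd]
    · intro z _ hz
      simp [Set.indicator, hz]
  have h5 : signedCount col σ (insert d P) b = signedCount col σ P b := by
    unfold signedCount
    refine Finset.sum_congr rfl fun z _ => ?_
    by_cases hz : z = d
    · subst hz; simp [Set.indicator, ht]
    · simp [Set.indicator, hz]
  apply hσ
  linarith

/-- An involution of `Z` that reverses the weights `w` makes them cancel. -/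
theorem sum_eq_zero_of_flip {X : Type*} [Fintype X] (Z : Set X) (w : X → ℤ) (g : X → X)
    (hZ : ∀ x ∈ Z, g x ∈ Z) (hg : ∀ x ∈ Z, g (g x) = x) (hw : ∀ x ∈ Z, w x + w (g x) = 0) :
    ∑ x, Z.indicator w x = 0 := by
  simp only [Set.indicator]
  rw [← Finset.sum_filter]
  refine Finset.sum_involution (fun x _ => g x) ?_ ?_ ?_ ?_
  · intro x hx; exact hw x (by simpa using hx)
  · intro x hx hne h
    have := hw x (by simpa using hx)
    rw [h] at this
    omega
  · intro x hx; simpa using hZ x (by simpa using hx)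
  · intro x hx; exact hg x (by simpa using hx)

/-- The sign of `x`, reversed if its color is not `a`. -/
noncomputable def signAt {X C : Type*} (col : X → C) (σ : X → ℤ) (a : C) (x : X) : ℤ :=
  if col x = a then σ x else -σ x

theorem signedCount_sub {X C : Type*} [Fintype X] (col : X → C) (σ : X → ℤ) (Z : Set X)
    {a b : C} (hab : a ≠ b) :
    signedCount col σ Z a - signedCount col σ Z b =
      ∑ x, (Z ∩ {x | col x ∈ s(a, b)}).indicator (signAt col σ a) x := by
  unfold signedCount
  rw [← Finset.sum_sub_distrib]
  refine Finset.sum_congr rfl fun x _ => ?_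
  by_cases hx : x ∈ Z <;> by_cases h1 : col x = a <;> by_cases h2 : col x = b <;>
    simp_all [Set.indicator, signAt]

/-! ### Orientations -/

namespace StrandedGraph

variable {n : ℕ} (G : StrandedGraph.{u} n)

noncomputable instance : Fintype G.PreEdge := Fintype.ofFinite _

instance : Finite G.HalfEdge := by unfold HalfEdge; infer_instance

noncomputable instance : Fintype G.HalfEdge := Fintype.ofFinite _

instance : Finite G.Point := by unfold Point; infer_instance

instance : Finite G.Face := by unfold Face; infer_instance

/-- Signs of the pre-edges such that an edge joins opposite signs, and a chord joins opposite signs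
if its ends have the same color and equal signs otherwise. In the stranded structure of a colored
tensor graph, the pre-edges at a vertex carry the sign of that vertex. -/
structure IsOrientation (σ : G.PreEdge → ℤ) : Prop where
  ne_zero : ∀ d, σ d ≠ 0
  chord : ∀ t d, G.IsPoint d t →
    σ (G.chord t d) = if G.color (G.chord t d) = G.color d then -σ d else σ d
  mate : ∀ d, G.mate d ≠ d → σ (G.mate d) = -σ d

/-- The existence of an orientation: the only property of representatives of w-colored graphs that
matters for the recursion. -/
def Orientable : Prop := ∃ σ, G.IsOrientation σ

variable {G}

theorem IsPoint.chord {t : Sym2 (Fin (n + 1))} {d : G.PreEdge} (h : G.IsPoint d t) :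
    G.IsPoint (G.chord t d) t := ⟨G.chord_color t d h.1 h.2, h.2⟩

theorem IsPoint.mate {t : Sym2 (Fin (n + 1))} {d : G.PreEdge} (h : G.IsPoint d t) :
    G.IsPoint (G.mate d) t := ⟨by rw [G.mate_color]; exact h.1, h.2⟩

theorem IsPoint.chord_chord {t : Sym2 (Fin (n + 1))} {d : G.PreEdge} (h : G.IsPoint d t) :
    G.chord t (G.chord t d) = d := G.chord_chord t d h.1 h.2

theorem IsPoint.chord_ne {t : Sym2 (Fin (n + 1))} {d : G.PreEdge} (h : G.IsPoint d t) :
    G.chord t d ≠ d := G.chord_ne t d h.1 h.2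

theorem _root_.ColoredTensorGraph.orientable_toStranded (K : ColoredTensorGraph.{u} n) :
    K.toStranded.Orientable := by
  refine ⟨fun d => if K.sign d.1 then 1 else -1, ?_, ?_, ?_⟩
  · intro d
    show (if K.sign d.1 then (1 : ℤ) else -1) ≠ 0
    split_ifs <;> decide
  · intro t d hd
    have hne : K.toStranded.color (K.toStranded.chord t d) ≠ K.toStranded.color d :=
      fun h => hd.chord_ne (Prod.ext rfl h)
    rw [if_neg hne]
    rfl
  · intro d hd
    have hne : K.nbr d.2 d.1 ≠ d.1 := fun h => hd (Prod.ext h rfl)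
    have := K.sign_nbr d.2 d.1 hne
    show (if K.sign (K.nbr d.2 d.1) then (1 : ℤ) else -1) = -(if K.sign d.1 then 1 else -1)
    cases h1 : K.sign d.1 <;> cases h2 : K.sign (K.nbr d.2 d.1) <;> simp_all

theorem Orientable.cutEdges (h : G.Orientable) (S : Set G.Edge) : (G.cutEdges S).Orientable := by
  obtain ⟨σ, h0, h1, h2⟩ := h
  refine ⟨σ, h0, h1, fun d hd => ?_⟩
  by_cases hS : ∃ e ∈ S, d ∈ e.1
  · exact absurd (if_pos hS) hd
  · have : (G.cutEdges S).mate d = G.mate d := if_neg hS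
    rw [this] at hd ⊢
    exact h2 d hd

theorem Orientable.contract (h : G.Orientable) (e : G.Edge) : (G.contract e).Orientable := by
  obtain ⟨σ, h0, h1, h2⟩ := h
  refine ⟨fun d => σ d.1, fun d => h0 d.1, ?_, ?_⟩
  · rintro t d ⟨hd, ht⟩
    have hp : G.IsPoint d.1 t := ⟨hd, ht⟩
    show σ (G.contractChord e t d).1 =
      if G.color (G.contractChord e t d).1 = G.color d.1 then -σ d.1 else σ d.1
    rcases G.contractChord_cases e t d hd ht with ⟨_, h⟩ | ⟨h, _, h'⟩
    · rw [h]; exact h1 t d.1 hp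
    · rw [h', h1 t _ hp.chord.mate, h2 _ (G.mate_ne_of_mem_edge e h), h1 t _ hp, G.mate_color]
      -- all three colors lie in the two-element set `t`
      have hx : G.color d.1 ∈ t := hp.1
      have hy := hp.chord.1
      have hz := hp.chord.mate.chord.1
      generalize G.color (G.chord t (G.mate (G.chord t d.1))) = z at *
      generalize G.color (G.chord t d.1) = y at *
      generalize G.color d.1 = x at *
      clear hp hd
      induction t with | _ a b =>
      rw [Sym2.mem_iff] at hx hy hz
      have hab : a ≠ b := by simpa using ht
      rcases hx with rfl | rfl <;> rcases hy with rfl | rfl <;> rcases hz with rfl | rfl <;>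
        simp [hab, hab.symm]
  · intro d hd
    exact h2 d.1 fun h => hd (Subtype.ext h)

theorem Orientable.contractsTo {H : StrandedGraph.{u} n} (h : G.Orientable)
    (hGH : G.ContractsTo H) : H.Orientable := by
  induction hGH with
  | refl => exact h
  | tail _ hstep ih =>
    obtain ⟨e, rfl⟩ := hstep
    exact ih.contract e

theorem Orientable.of_discEquiv {H : StrandedGraph.{u} n} (h : G.Orientable)
    (hGH : H.DiscEquiv G) : H.Orientable := by
  obtain ⟨σ, h0, h1, h2⟩ := h
  obtain ⟨φ, k1, k2, k3⟩ := hGH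
  refine ⟨fun d => σ (φ d), fun d => h0 _, ?_, ?_⟩
  · intro t d hd
    have hd' : G.IsPoint (φ d) t := ⟨by rw [k1]; exact hd.1, hd.2⟩
    have := h1 t (φ d) hd'
    rw [k3 t d hd, k1, k1] at this
    exact this
  · intro d hd
    show σ (φ (H.mate d)) = -σ (φ d)
    rw [← k2]
    refine h2 _ fun h => hd ?_
    rw [k2] at h
    exact φ.injective h

theorem _root_.WColoredGraph.IsRepresentative.orientable {W : WColoredGraph.{u} n}
    (hG : W.IsRepresentative G) : G.Orientable := by
  obtain ⟨K, H, hKH, hW⟩ := W.exists_contraction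
  have hGH : G.DiscEquiv H := Quotient.exact (Eq.trans hG hW)
  exact (K.orientable_toStranded.contractsTo hKH).of_discEquiv hGH

/-! ### Balance of chords and of open faces -/

theorem IsOrientation.signAt_chord {σ : G.PreEdge → ℤ} (hσ : G.IsOrientation σ)
    {a b : Fin (n + 1)} {d : G.PreEdge} (hd : G.IsPoint d s(a, b)) :
    signAt G.color σ a d + signAt G.color σ a (G.chord s(a, b) d) = 0 := by
  unfold signAt
  rw [hσ.chord _ _ hd]
  have hx := Sym2.mem_iff.1 hd.1
  have hy := Sym2.mem_iff.1 hd.chord.1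
  have hab : a ≠ b := by simpa using hd.2
  generalize G.color (G.chord s(a, b) d) = y at *
  generalize G.color d = x at *
  rcases hx with rfl | rfl <;> rcases hy with rfl | rfl <;> simp_all [eq_comm]

theorem IsOrientation.signAt_mate {σ : G.PreEdge → ℤ} (hσ : G.IsOrientation σ)
    {a : Fin (n + 1)} {d : G.PreEdge} (hd : G.mate d ≠ d) :
    signAt G.color σ a d + signAt G.color σ a (G.mate d) = 0 := by
  unfold signAt
  rw [hσ.mate _ hd, G.mate_color]
  split_ifs <;> simp

/-- `x` and `y` are the same point or the two ends of a chord, in the pair `t`. -/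
def ChordLink (G : StrandedGraph.{u} n) (t : Sym2 (Fin (n + 1))) (x y : G.PreEdge) : Prop :=
  G.IsPoint x t ∧ (y = x ∨ y = G.chord t x)

theorem ChordLink.symm {t : Sym2 (Fin (n + 1))} {x y : G.PreEdge} (h : G.ChordLink t x y) :
    G.ChordLink t y x := by
  obtain ⟨hx, rfl | rfl⟩ := h
  · exact ⟨hx, Or.inl rfl⟩
  · exact ⟨hx.chord, Or.inr hx.chord_chord.symm⟩

theorem ChordLink.trans {t : Sym2 (Fin (n + 1))} {x y z : G.PreEdge} (h : G.ChordLink t x y)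
    (h' : G.ChordLink t y z) : G.ChordLink t x z := by
  obtain ⟨hx, rfl | rfl⟩ := h
  · exact h'
  · obtain ⟨_, rfl | rfl⟩ := h'
    · exact ⟨hx, Or.inr rfl⟩
    · exact ⟨hx, Or.inl hx.chord_chord⟩

theorem ChordLink.right {t : Sym2 (Fin (n + 1))} {x y : G.PreEdge} (h : G.ChordLink t x y) :
    G.IsPoint y t := h.symm.1

/-- In an oriented graph, a set of pre-edges other than `d` that is closed under the chords in `S`
that avoid `d` contains either all neighbors of `d` through such chords or none. -/
theorem Orientable.chord_mem (hG : G.Orientable) (S : Finset (Fin (n + 1))) {d : G.PreEdge}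
    (P : Set G.PreEdge) (hd : d ∉ P)
    (hP : ∀ t, (∀ c ∈ t, c ∈ S) → ∀ x ∈ P, G.IsPoint x t → G.chord t x ≠ d → G.chord t x ∈ P)
    {t t' : Sym2 (Fin (n + 1))} (ht : G.IsPoint d t) (ht' : G.IsPoint d t')
    (htS : ∀ c ∈ t, c ∈ S) (htS' : ∀ c ∈ t', c ∈ S) (h : G.chord t d ∈ P) :
    G.chord t' d ∈ P := by
  obtain ⟨σ, hσ⟩ := hG
  refine mem_of_balanced G.color σ G.ChordLink (fun _ _ _ => ChordLink.symm)
    (fun _ _ _ _ => ChordLink.trans) (fun _ _ _ h => h.right.1) ?_ S P (hσ.ne_zero d) hd ?_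
    ht.2 ht'.2 htS htS' h ⟨ht.chord, Or.inr ht.chord_chord.symm⟩ ⟨ht', Or.inr rfl⟩ ht'.chord_ne
  · intro a b hab Z hZ
    rw [← sub_eq_zero, signedCount_sub _ _ _ hab]
    have hpt : ∀ x ∈ Z ∩ {x | G.color x ∈ s(a, b)}, G.IsPoint x s(a, b) :=
      fun x hx => ⟨hx.2, by simpa using hab⟩
    exact sum_eq_zero_of_flip (Z ∩ {x | G.color x ∈ s(a, b)}) (signAt G.color σ a)
      (G.chord s(a, b)) (fun x hx => ⟨hZ x hx.1 _ ⟨hpt x hx, Or.inr rfl⟩, (hpt x hx).chord.1⟩)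
      (fun x hx => (hpt x hx).chord_chord) (fun x hx => hσ.signAt_chord (hpt x hx))
  · rintro t - htS x hx y hy ⟨hxt, rfl | rfl⟩
    · exact hx
    · exact hP t htS x hx hxt hy

theorem BoundaryAdj.symm {t : Sym2 (Fin (n + 1))} {x y : G.HalfEdge} (h : G.BoundaryAdj t x y) :
    G.BoundaryAdj t y x := by
  obtain ⟨h1, h2, h3⟩ := h
  exact ⟨h2, h1, h3.symm⟩

theorem BoundaryAdj.trans {t : Sym2 (Fin (n + 1))} {x y z : G.HalfEdge}
    (h : G.BoundaryAdj t x y) (h' : G.BoundaryAdj t y z) : G.BoundaryAdj t x z := by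
  obtain ⟨h1, h2, h3⟩ := h
  obtain ⟨_, k2, k3⟩ := h'
  exact ⟨h1, k2, h3.trans k3⟩

theorem faceOf_chord {t : Sym2 (Fin (n + 1))} {d : G.PreEdge} (h : G.IsPoint d t) :
    G.faceOf ⟨(G.chord t d, t), h.chord⟩ = G.faceOf ⟨(d, t), h⟩ :=
  (Quot.sound ⟨rfl, Or.inl rfl⟩).symm

theorem faceOf_mate {t : Sym2 (Fin (n + 1))} {d : G.PreEdge} (h : G.IsPoint d t) :
    G.faceOf ⟨(G.mate d, t), h.mate⟩ = G.faceOf ⟨(d, t), h⟩ :=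
  (Quot.sound ⟨rfl, Or.inr rfl⟩).symm

/-- The half-edges at the ends of the open faces with color pair `{a, b}` are balanced: summed over
all points of a face, and also over those that are not on a half-edge, the signs cancel. -/
theorem IsOrientation.boundary_balanced {σ : G.PreEdge → ℤ} (hσ : G.IsOrientation σ)
    {a b : Fin (n + 1)} (hab : a ≠ b) (Z : Set G.HalfEdge)
    (hZ : ∀ x ∈ Z, ∀ y, G.BoundaryAdj s(a, b) x y → y ∈ Z) :
    signedCount (fun h : G.HalfEdge => G.color h.1) (fun h => σ h.1) Z a =
      signedCount (fun h : G.HalfEdge => G.color h.1) (fun h => σ h.1) Z b := by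
  rw [← sub_eq_zero, signedCount_sub _ _ _ hab]
  set U : Set G.PreEdge := {d | ∃ (hd : G.IsPoint d s(a, b)) (h : G.HalfEdge)
    (ph : G.IsPoint h.1 s(a, b)), h ∈ Z ∧
      G.faceOf ⟨(d, s(a, b)), hd⟩ = G.faceOf ⟨(h.1, s(a, b)), ph⟩} with hU
  have h1 : ∑ x, U.indicator (signAt G.color σ a) x = 0 := by
    refine sum_eq_zero_of_flip U _ (G.chord s(a, b)) ?_ ?_ ?_
    · rintro x ⟨hx, h, ph, hh, hf⟩
      exact ⟨hx.chord, h, ph, hh, (faceOf_chord hx).trans hf⟩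
    · rintro x ⟨hx, -⟩; exact hx.chord_chord
    · rintro x ⟨hx, -⟩; exact hσ.signAt_chord hx
  have h2 : ∑ x, (U ∩ {x | G.mate x ≠ x}).indicator (signAt G.color σ a) x = 0 := by
    refine sum_eq_zero_of_flip (U ∩ {x | G.mate x ≠ x}) _ G.mate ?_ ?_ ?_
    · rintro x ⟨⟨hx, h, ph, hh, hf⟩, hm⟩
      refine ⟨⟨hx.mate, h, ph, hh, (faceOf_mate hx).trans hf⟩, ?_⟩
      rw [Set.mem_ofPred_eq, G.mate_mate]
      exact fun h => hm h.symm
    · intro x _; exact G.mate_mate x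
    · rintro x ⟨-, hm⟩; exact hσ.signAt_mate hm
  have h3 : ∑ x, (U ∩ {x | G.mate x = x}).indicator (signAt G.color σ a) x = 0 := by
    rw [← h1, eq_comm, ← sub_eq_zero, ← Finset.sum_sub_distrib, ← h2]
    refine Finset.sum_congr rfl fun x _ => ?_
    by_cases hx : x ∈ U <;> by_cases hm : G.mate x = x <;> simp [Set.indicator, hx, hm]
  rw [← h3]
  refine Fintype.sum_of_injective (fun h : G.HalfEdge => h.1) Subtype.val_injective _ _ ?_ ?_
  · intro x hx
    refine Set.indicator_of_notMem (fun h => hx ⟨⟨x, h.2⟩, rfl⟩) _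
  · intro h
    have hiff : h ∈ Z ∩ {x | G.color x.1 ∈ s(a, b)} ↔ h.1 ∈ U ∩ {x | G.mate x = x} := by
      constructor
      · rintro ⟨hh, hc⟩
        exact ⟨⟨⟨hc, by simpa using hab⟩, h, ⟨hc, by simpa using hab⟩, hh, rfl⟩, h.2⟩
      · rintro ⟨⟨hp, h', ph', hh', hf⟩, -⟩
        exact ⟨hZ h' hh' h ⟨ph', hp, hf.symm⟩, hp.1⟩
    by_cases hh : h.1 ∈ U ∩ {x | G.mate x = x}
    · rw [Set.indicator_of_mem hh, Set.indicator_of_mem (hiff.2 hh)]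
      rfl
    · rw [Set.indicator_of_notMem hh, Set.indicator_of_notMem fun h => hh (hiff.1 h)]

/-- In an oriented graph, a set of half-edges other than `d` that is closed under the edges in `S`
of the boundary graph that avoid `d` contains either all neighbors of `d` through such edges or
none. -/
theorem Orientable.boundaryAdj_mem (hG : G.Orientable) (S : Finset (Fin (n + 1)))
    {d : G.HalfEdge} (P : Set G.HalfEdge) (hd : d ∉ P)
    (hP : ∀ t, (∀ c ∈ t, c ∈ S) → ∀ x ∈ P, ∀ y, y ≠ d → G.BoundaryAdj t x y → y ∈ P)
    {t t' : Sym2 (Fin (n + 1))} (htS : ∀ c ∈ t, c ∈ S) (htS' : ∀ c ∈ t', c ∈ S)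
    {x y : G.HalfEdge} (hx : x ∈ P) (hxd : G.BoundaryAdj t x d) (hdy : G.BoundaryAdj t' d y)
    (hy : y ≠ d) : y ∈ P := by
  obtain ⟨σ, hσ⟩ := hG
  obtain ⟨_, ht, _⟩ := id hxd
  obtain ⟨ht', _, _⟩ := id hdy
  exact mem_of_balanced (fun h : G.HalfEdge => G.color h.1) (fun h => σ h.1) G.BoundaryAdj
    (fun _ _ _ => BoundaryAdj.symm) (fun _ _ _ _ => BoundaryAdj.trans)
    (fun _ _ _ h => h.symm.choose.1) (fun a b hab Z hZ => hσ.boundary_balanced hab Z hZ) S P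
    (hσ.ne_zero d.1) hd (fun t _ htS x hx y hy h => hP t htS x hx y hy h)
    ht.2 ht'.2 htS htS' hx hxd hdy hy

/-- An open face has a second end. -/
theorem Orientable.exists_boundaryAdj (hG : G.Orientable) (d : G.HalfEdge)
    {t : Sym2 (Fin (n + 1))} (ht : G.IsPoint d.1 t) : ∃ y, y ≠ d ∧ G.BoundaryAdj t d y := by
  obtain ⟨σ, hσ⟩ := hG
  by_contra! hcon
  obtain ⟨b, rfl⟩ := ht.1
  have hab : G.color d.1 ≠ b := by simpa using ht.2
  have h := hσ.boundary_balanced hab {d} (by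
    rintro x rfl y hy
    by_contra hne
    exact hcon y hne hy)
  apply hσ.ne_zero d.1
  have h1 : signedCount (fun h : G.HalfEdge => G.color h.1) (fun h => σ h.1) {d} (G.color d.1) =
      σ d.1 := by
    unfold signedCount
    rw [Finset.sum_eq_single_of_mem d (Finset.mem_univ d)]
    · simp [Set.indicator]
    · intro z _ hz
      simp [Set.indicator, hz]
  rw [← h1, h]
  refine Finset.sum_eq_zero fun z _ => ?_
  refine Set.indicator_of_notMem ?_ _
  rintro ⟨rfl, hz⟩
  exact hab hz

end StrandedGraph

/-! ### Adjacency relations of a stranded graph -/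

namespace StrandedGraph

variable {n : ℕ} (G : StrandedGraph.{u} n)

/-- Adjacency of pre-edges through chords, edges and half-edges. Its classes are the connected
components other than the discs. -/
def compRel (d d' : G.PreEdge) : Prop :=
  (∃ t, G.IsPoint d t ∧ d' = G.chord t d) ∨ d' = G.mate d

/-- The part of `compRel` that uses only colors in `S`. -/
def bubbleRel (S : Finset (Fin (n + 1))) (d d' : {d : G.PreEdge // G.color d ∈ S}) : Prop :=
  (∃ t, G.IsPoint d.1 t ∧ (∀ c ∈ t, c ∈ S) ∧ d'.1 = G.chord t d.1) ∨ d'.1 = G.mate d.1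

/-- Adjacency of points along chords and strands; the classes are the faces. -/
def faceRel (p p' : G.Point) : Prop :=
  p'.1.2 = p.1.2 ∧ (p'.1.1 = G.chord p.1.2 p.1.1 ∨ p'.1.1 = G.mate p.1.1)

/-- Adjacency of half-edges with color in `S` through open faces with color pair in `S`. -/
def bdryRel (S : Finset (Fin (n + 1))) (h h' : {h : G.HalfEdge // G.color h.1 ∈ S}) : Prop :=
  ∃ t, (∀ c ∈ t, c ∈ S) ∧ G.BoundaryAdj t h.1 h'.1

theorem numComponents_eq :
    G.numComponents = Nat.card (Quot (G.bubbleRel Finset.univ)) + G.discs := by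
  refine congrArg (· + G.discs) (Quot.card_eq_of_retract (r := G.compRel)
    (r' := G.bubbleRel Finset.univ) (fun d => ⟨d, Finset.mem_univ _⟩) (fun d => d.1) ?_ ?_
    (fun _ => rfl) (fun _ => rfl))
  · rintro a b (⟨t, ht, h⟩ | h)
    · exact Quot.sound (Or.inl ⟨t, ht, fun _ _ => Finset.mem_univ _, h⟩)
    · exact Quot.sound (Or.inr h)
  · rintro a b (⟨t, ht, -, h⟩ | h)
    · exact Quot.sound (Or.inl ⟨t, ht, h⟩)
    · exact Quot.sound (Or.inr h)

theorem numBdryComponents_eq :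
    G.numBdryComponents = Nat.card (Quot (G.bdryRel Finset.univ)) := by
  refine Quot.card_eq_of_retract (r := fun h h' : G.HalfEdge => ∃ t, G.BoundaryAdj t h h')
    (r' := G.bdryRel Finset.univ) (fun d => ⟨d, Finset.mem_univ _⟩) (fun d => d.1) ?_ ?_
    (fun _ => rfl) (fun _ => rfl)
  · rintro a b ⟨t, h⟩
    exact Quot.sound ⟨t, fun _ _ => Finset.mem_univ _, h⟩
  · rintro a b ⟨t, -, h⟩
    exact Quot.sound ⟨t, h⟩

variable {G}

theorem pair_eq_of_faceOf_eq {p q : G.Point} (h : G.faceOf p = G.faceOf q) : p.1.2 = q.1.2 :=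
  Quot.apply_eq_of_mk_eq (r := G.faceRel) (fun p => p.1.2) (fun _ _ h => h.1.symm) h

theorem connected_of_faceOf_eq {p q : G.Point} (h : G.faceOf p = G.faceOf q) :
    Quot.mk G.compRel p.1.1 = Quot.mk G.compRel q.1.1 := by
  refine Quot.apply_eq_of_mk_eq (r := G.faceRel) (fun p => Quot.mk G.compRel p.1.1) ?_ h
  rintro a b ⟨-, h | h⟩
  · exact Quot.sound (Or.inl ⟨_, a.2, h⟩)
  · exact Quot.sound (Or.inr h)

theorem BoundaryAdj.connected {t : Sym2 (Fin (n + 1))} {x y : G.HalfEdge}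
    (h : G.BoundaryAdj t x y) : Quot.mk G.compRel x.1 = Quot.mk G.compRel y.1 := by
  obtain ⟨_, _, h⟩ := h
  exact connected_of_faceOf_eq h

theorem connected_of_bubbleRel {S : Finset (Fin (n + 1))}
    {x y : {d : G.PreEdge // G.color d ∈ S}}
    (h : Quot.mk (G.bubbleRel S) x = Quot.mk (G.bubbleRel S) y) :
    Quot.mk G.compRel x.1 = Quot.mk G.compRel y.1 := by
  refine Quot.mk_eq_of_map (fun x => x.1) ?_ h
  rintro a b (⟨t, ht, -, h⟩ | h)
  · exact Quot.sound (Or.inl ⟨t, ht, h⟩)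
  · exact Quot.sound (Or.inr h)

theorem connected_of_bdryRel {S : Finset (Fin (n + 1))}
    {x y : {d : G.HalfEdge // G.color d.1 ∈ S}}
    (h : Quot.mk (G.bdryRel S) x = Quot.mk (G.bdryRel S) y) :
    Quot.mk G.compRel x.1.1 = Quot.mk G.compRel y.1.1 := by
  refine Quot.apply_eq_of_mk_eq (fun x => Quot.mk G.compRel x.1.1) ?_ h
  rintro a b ⟨t, -, h⟩
  exact h.connected

/-! ### Pre-edges of an edge -/

theorem mem_edge_iff (e : G.Edge) {d x : G.PreEdge} (hd : d ∈ e.1) :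
    x ∈ e.1 ↔ x = d ∨ x = G.mate d := by
  refine ⟨G.eq_or_eq_mate_of_mem_edge e hd, ?_⟩
  rintro (rfl | rfl)
  · exact hd
  · exact (G.mate_mem_edge e d).2 hd

theorem color_of_mem_edge (e : G.Edge) {d x : G.PreEdge} (hd : d ∈ e.1) (hx : x ∈ e.1) :
    G.color x = G.color d := by
  rcases (mem_edge_iff e hd).1 hx with rfl | rfl
  · rfl
  · exact G.mate_color d

theorem cut_mate_of_mem {e : G.Edge} {x : G.PreEdge} (hx : x ∈ e.1) : (G.cut e).mate x = x :=
  if_pos ⟨e, rfl, hx⟩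

theorem cut_mate_of_notMem {e : G.Edge} {x : G.PreEdge} (hx : x ∉ e.1) :
    (G.cut e).mate x = G.mate x :=
  if_neg fun ⟨_, he, h⟩ => hx (Set.mem_singleton_iff.1 he ▸ h)

theorem cut_mate_of_halfEdge {e : G.Edge} {x : G.PreEdge} (hx : G.mate x = x) :
    (G.cut e).mate x = x := by
  by_cases h : x ∈ e.1
  · exact cut_mate_of_mem h
  · rw [cut_mate_of_notMem h, hx]

theorem cut_mate_eq_self {e : G.Edge} {x : G.PreEdge} :
    (G.cut e).mate x = x ↔ G.mate x = x ∨ x ∈ e.1 := by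
  by_cases h : x ∈ e.1
  · exact iff_of_true (cut_mate_of_mem h) (Or.inr h)
  · rw [cut_mate_of_notMem h, or_iff_left h]
    exact Iff.rfl

/-! ### Counting color pairs and color sets -/

theorem card_isPoint (d : G.PreEdge) : Nat.card {t // G.IsPoint d t} = n := by
  have h1 : Nat.card {c : Fin (n + 1) // c ≠ G.color d} = n := by
    rw [Nat.card_eq_fintype_card, Fintype.card_subtype_compl]
    simp
  refine Eq.trans (Eq.symm ?_) h1
  refine Nat.card_congr (Equiv.ofBijective
    (fun c => ⟨s(G.color d, c.1), Sym2.mem_mk_left _ _, ?_⟩) ⟨?_, ?_⟩)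
  · have := c.2
    rw [Sym2.mk_isDiag_iff]
    exact this.symm
  · rintro ⟨a, ha⟩ ⟨b, hb⟩ h
    have h' : s(G.color d, a) = s(G.color d, b) := congrArg Subtype.val h
    exact Subtype.ext (Sym2.congr_right.1 h')
  · rintro ⟨t, ⟨b, rfl⟩, ht⟩
    rw [Sym2.mk_isDiag_iff] at ht
    exact ⟨⟨b, fun h => ht h.symm⟩, rfl⟩

theorem card_powersetCard_mem (c : Fin (n + 1)) (p : ℕ) :
    (((Finset.univ : Finset (Fin (n + 1))).powersetCard (p + 1)).filter (c ∈ ·)).card =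
      n.choose p := by
  have h : ((Finset.univ : Finset (Fin (n + 1))).powersetCard (p + 1)).filter (c ∈ ·) =
      (((Finset.univ : Finset (Fin (n + 1))).erase c).powersetCard p).image (insert c) := by
    ext S
    simp only [Finset.mem_filter, Finset.mem_image, Finset.mem_powersetCard]
    constructor
    · rintro ⟨⟨-, hS⟩, hc⟩
      refine ⟨S.erase c, ⟨Finset.erase_subset_erase _ (Finset.subset_univ _), ?_⟩,
        Finset.insert_erase hc⟩
      rw [Finset.card_erase_of_mem hc, hS]; rfl
    · rintro ⟨T, ⟨hT, hp⟩, rfl⟩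
      have hc : c ∉ T := fun h => by simpa using hT h
      exact ⟨⟨Finset.subset_univ _, by rw [Finset.card_insert_of_notMem hc, hp]⟩,
        Finset.mem_insert_self _ _⟩
  rw [h, Finset.card_image_of_injOn, Finset.card_powersetCard,
    Finset.card_erase_of_mem (Finset.mem_univ _), Finset.card_univ, Fintype.card_fin]
  · rfl
  · intro T hT T' hT' hTT
    have hc : ∀ U : Finset (Fin (n + 1)),
        U ∈ (((Finset.univ : Finset (Fin (n + 1))).erase c).powersetCard p : Set _) →
        c ∉ U := fun U hU h => by
      simpa using (Finset.mem_powersetCard.1 hU).1 h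
    have hTT' : insert c T = insert c T' := hTT
    rw [← Finset.erase_insert (hc T hT), hTT', Finset.erase_insert (hc T' hT')]

/-- A sum over the color sets of size `p + 1` of numbers that grow by one exactly for the sets
containing `c`. -/
theorem sum_powersetCard_add_one (c : Fin (n + 1)) (p : ℕ) (f g : Finset (Fin (n + 1)) → ℕ)
    (h1 : ∀ S, S.card = p + 1 → c ∈ S → f S = g S + 1)
    (h2 : ∀ S, S.card = p + 1 → c ∉ S → f S = g S) :
    ∑ S ∈ (Finset.univ : Finset (Fin (n + 1))).powersetCard (p + 1), f S =
      ∑ S ∈ (Finset.univ : Finset (Fin (n + 1))).powersetCard (p + 1), g S + n.choose p := by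
  rw [← card_powersetCard_mem c p, Finset.card_filter, ← Finset.sum_add_distrib]
  refine Finset.sum_congr rfl fun S hS => ?_
  rw [Finset.mem_powersetCard_univ] at hS
  split_ifs with hc
  · exact h1 S hS hc
  · exact h2 S hS hc

/-- A set of at least two colors contains a pair through each of its colors. -/
theorem exists_pair {S : Finset (Fin (n + 1))} (hS : 2 ≤ S.card) {c : Fin (n + 1)}
    (hc : c ∈ S) : ∃ t : Sym2 (Fin (n + 1)), c ∈ t ∧ ¬ t.IsDiag ∧ ∀ a ∈ t, a ∈ S := by
  obtain ⟨b, hb, hbc⟩ := Finset.exists_mem_ne (by omega : 1 < S.card) c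
  refine ⟨s(c, b), Sym2.mem_mk_left _ _, ?_, ?_⟩
  · rw [Sym2.mk_isDiag_iff]; exact hbc.symm
  · intro a ha
    rcases Sym2.mem_iff.1 ha with rfl | rfl
    exacts [hc, hb]

/-! ### Components and bubbles after cutting a bridge -/

theorem compRel_of_cut {e : G.Edge} {x y : G.PreEdge}
    (h : Quot.mk (G.cut e).compRel x = Quot.mk (G.cut e).compRel y) :
    Quot.mk G.compRel x = Quot.mk G.compRel y := by
  refine Quot.apply_eq_of_mk_eq (r := (G.cut e).compRel)
    (fun x : G.PreEdge => Quot.mk G.compRel x) ?_ h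
  rintro a b (⟨t, ht, h⟩ | h)
  · exact Quot.sound (Or.inl ⟨t, ht, h⟩)
  · by_cases ha : a ∈ e.1
    · rw [h, cut_mate_of_mem ha]
    · exact Quot.sound (Or.inr (h.trans (cut_mate_of_notMem ha)))

theorem card_bubbleRel_cut {e : G.Edge} {d : G.PreEdge} (hd : d ∈ e.1)
    (hb : Quot.mk (G.cut e).compRel d ≠ Quot.mk (G.cut e).compRel (G.mate d))
    {S : Finset (Fin (n + 1))} (hS : G.color d ∈ S) :
    Nat.card (Quot ((G.cut e).bubbleRel S)) = Nat.card (Quot (G.bubbleRel S)) + 1 := by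
  have := Quot.card_glue (X := {x : G.PreEdge // G.color x ∈ S}) (I := Unit)
    (r := (G.cut e).bubbleRel S) (r' := G.bubbleRel S) (a := fun _ => ⟨d, hS⟩)
    (b := fun _ => ⟨G.mate d, by rw [G.mate_color]; exact hS⟩) ?_ ?_ ?_ ?_ ?_
  · rw [Nat.card_unique (α := Unit)] at this
    exact this
  · rintro x y (⟨t, ht, hS, h⟩ | h)
    · exact Quot.sound (Or.inl ⟨t, ht, hS, h⟩)
    · by_cases ha : x.1 ∈ e.1
      · rw [show y = x from Subtype.ext (h.trans (cut_mate_of_mem ha))]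
      · exact Quot.sound (Or.inr (h.trans (cut_mate_of_notMem ha)))
  · intro _
    exact Quot.sound (Or.inr rfl)
  · rintro x y (⟨t, ht, hS, h⟩ | h)
    · exact Or.inl (Quot.sound (Or.inl ⟨t, ht, hS, h⟩))
    · by_cases ha : x.1 ∈ e.1
      · refine Or.inr ⟨(), ?_⟩
        rcases (mem_edge_iff e hd).1 ha with hx | hx
        · exact Or.inl ⟨Subtype.ext hx, Subtype.ext (by rw [h, hx])⟩
        · exact Or.inr ⟨Subtype.ext hx, Subtype.ext (by rw [h, hx, G.mate_mate])⟩
      · exact Or.inl (Quot.sound (Or.inr (h.trans (cut_mate_of_notMem ha).symm)))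
  · intro _ _ h
    exact hb (connected_of_bubbleRel (G := G.cut e) h).symm
  · intro _ _ _; rfl

theorem card_bubbleRel_cut_of_notMem {e : G.Edge} {d : G.PreEdge} (hd : d ∈ e.1)
    {S : Finset (Fin (n + 1))} (hS : G.color d ∉ S) :
    Nat.card (Quot ((G.cut e).bubbleRel S)) = Nat.card (Quot (G.bubbleRel S)) := by
  have key : (G.cut e).bubbleRel S = G.bubbleRel S := by
    funext x y
    have hx : x.1 ∉ e.1 := fun h => hS (color_of_mem_edge e hd h ▸ x.2)
    have : (G.cut e).mate x.1 = G.mate x.1 := cut_mate_of_notMem hx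
    unfold bubbleRel
    rw [this]
    rfl
  rw [key]
  rfl

theorem numComponents_cut {e : G.Edge} {d : G.PreEdge} (hd : d ∈ e.1)
    (hb : Quot.mk (G.cut e).compRel d ≠ Quot.mk (G.cut e).compRel (G.mate d)) :
    (G.cut e).numComponents = G.numComponents + 1 := by
  rw [numComponents_eq, numComponents_eq, card_bubbleRel_cut hd hb (Finset.mem_univ _)]
  have : (G.cut e).discs = G.discs := rfl
  omega

theorem numComponents_cut_of_connected {e : G.Edge} {d : G.PreEdge} (hd : d ∈ e.1)
    (hb : Quot.mk (G.cut e).compRel d = Quot.mk (G.cut e).compRel (G.mate d)) :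
    (G.cut e).numComponents = G.numComponents := by
  refine congrArg (· + G.discs) (Quot.card_eq_of_retract (r := (G.cut e).compRel)
    (r' := G.compRel) (fun x => x) (fun x => x) ?_ ?_ (fun _ => rfl) (fun _ => rfl))
  · intro a b h
    exact compRel_of_cut (Quot.sound h)
  · rintro a b (⟨t, ht, h⟩ | h)
    · exact Quot.sound (Or.inl ⟨t, ht, h⟩)
    · by_cases ha : a ∈ e.1
      · rcases (mem_edge_iff e hd).1 ha with rfl | rfl
        · rw [h]; exact hb
        · rw [h, G.mate_mate]; exact hb.symm
      · exact Quot.sound (Or.inr (h.trans (cut_mate_of_notMem ha).symm))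

theorem isBridge_iff {e : G.Edge} {d : G.PreEdge} (hd : d ∈ e.1) :
    G.IsBridge e ↔ Quot.mk (G.cut e).compRel d ≠ Quot.mk (G.cut e).compRel (G.mate d) := by
  unfold IsBridge
  by_cases hb : Quot.mk (G.cut e).compRel d = Quot.mk (G.cut e).compRel (G.mate d)
  · simp [hb, numComponents_cut_of_connected hd hb]
  · simp [hb, numComponents_cut hd hb]

theorem numBubbles_cut {e : G.Edge} {d : G.PreEdge} (hd : d ∈ e.1)
    (hb : Quot.mk (G.cut e).compRel d ≠ Quot.mk (G.cut e).compRel (G.mate d)) (p : ℕ) :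
    (G.cut e).numBubbles (p + 1) = G.numBubbles (p + 1) + n.choose p :=
  sum_powersetCard_add_one (G.color d) p (fun S => Nat.card (Quot ((G.cut e).bubbleRel S)))
    (fun S => Nat.card (Quot (G.bubbleRel S)))
    (fun _ _ h => card_bubbleRel_cut hd hb h) (fun _ _ h => card_bubbleRel_cut_of_notMem hd h)

theorem numHalfEdges_cut (e : G.Edge) :
    (G.cut e).numHalfEdges = G.numHalfEdges + 2 := by
  obtain ⟨d, hd, he⟩ := id e.2
  have hmem : ∀ x, x ∈ e.1 ↔ x ∈ ({d, G.mate d} : Set G.PreEdge) := by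
    intro x; rw [he]; simp
  have h1 : (G.cut e).numHalfEdges = ({x | G.mate x = x} ∪ {d, G.mate d} : Set G.PreEdge).ncard := by
    rw [← Nat.card_coe_set_eq]
    refine Nat.card_congr (Equiv.subtypeEquivRight fun x => ?_)
    exact cut_mate_eq_self.trans (or_congr_right (hmem x))
  rw [h1, Set.ncard_union_eq, Set.ncard_pair hd.symm]
  · rfl
  · rw [Set.disjoint_right]
    intro x hx
    exact G.mate_ne_of_mem_edge e ((hmem x).2 hx)

/-! ### Faces after cutting a bridge -/

theorem mk_cut_faceRel {e : G.Edge} (x y : G.Point) (h : (G.cut e).faceRel x y) :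
    Quot.mk G.faceRel x = Quot.mk G.faceRel y := by
  obtain ⟨ht, h | h⟩ := h
  · exact Quot.sound ⟨ht, Or.inl h⟩
  · by_cases hx : x.1.1 ∈ e.1
    · have h' : (G.cut e).mate x.1.1 = x.1.1 := cut_mate_of_mem hx
      rw [show y = x from Subtype.ext (Prod.ext (h.trans h') ht)]
    · have h' : (G.cut e).mate x.1.1 = G.mate x.1.1 := cut_mate_of_notMem hx
      exact Quot.sound ⟨ht, Or.inr (h.trans h')⟩

theorem faceOf_of_cut {e : G.Edge} {x y : G.Point} (h : (G.cut e).faceOf x = (G.cut e).faceOf y) :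
    G.faceOf x = G.faceOf y :=
  Quot.apply_eq_of_mk_eq (X := G.Point) (r := (G.cut e).faceRel) G.faceOf mk_cut_faceRel h

theorem faceRel_or_cut {e : G.Edge} {d : G.PreEdge} (hd : d ∈ e.1) (x y : G.Point)
    (h : G.faceRel x y) :
    (Quot.mk (G.cut e).faceRel x = Quot.mk (G.cut e).faceRel y) ∨
      ∃ i : {t // G.IsPoint d t}, (x = ⟨(d, i.1), i.2⟩ ∧ y = ⟨(G.mate d, i.1), i.2.mate⟩) ∨
        (x = ⟨(G.mate d, i.1), i.2.mate⟩ ∧ y = ⟨(d, i.1), i.2⟩) := by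
  obtain ⟨⟨x, t⟩, hx⟩ := x
  obtain ⟨⟨y, t'⟩, hy⟩ := y
  obtain ⟨rfl, h | h⟩ := h
  · exact Or.inl (Quot.sound ⟨rfl, Or.inl h⟩)
  · dsimp only at h hx
    by_cases he : x ∈ e.1
    · right
      rcases (mem_edge_iff e hd).1 he with rfl | rfl
      · subst h
        exact ⟨⟨_, hx⟩, Or.inl ⟨rfl, rfl⟩⟩
      · rw [G.mate_mate] at h
        subst h
        exact ⟨⟨_, hy⟩, Or.inr ⟨rfl, rfl⟩⟩
    · exact Or.inl (Quot.sound ⟨rfl, Or.inr (h.trans (cut_mate_of_notMem he).symm)⟩)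

/-- Cutting a bridge separates, for each of its strands, the two ends of the face along it. -/
theorem faceOf_cut_cases {e : G.Edge} {d : G.PreEdge} (hd : d ∈ e.1)
    (hb : Quot.mk (G.cut e).compRel d ≠ Quot.mk (G.cut e).compRel (G.mate d)) {x y : G.Point}
    (h : G.faceOf x = G.faceOf y) :
    (G.cut e).faceOf x = (G.cut e).faceOf y ∨ ∃ i : {t // G.IsPoint d t},
      ((G.cut e).faceOf x = (G.cut e).faceOf ⟨(d, i.1), i.2⟩ ∧
        (G.cut e).faceOf y = (G.cut e).faceOf ⟨(G.mate d, i.1), i.2.mate⟩) ∨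
      ((G.cut e).faceOf x = (G.cut e).faceOf ⟨(G.mate d, i.1), i.2.mate⟩ ∧
        (G.cut e).faceOf y = (G.cut e).faceOf ⟨(d, i.1), i.2⟩) := by
  refine mk_eq_or_of_glue (X := G.Point) (I := {t // G.IsPoint d t}) (r := (G.cut e).faceRel)
    (r' := G.faceRel) (a := fun i => ⟨(d, i.1), i.2⟩)
    (b := fun i => ⟨(G.mate d, i.1), i.2.mate⟩) (faceRel_or_cut hd) ?_ ?_ ?_ h
  · intro i j h
    exact hb (connected_of_faceOf_eq (G := G.cut e) h).symm
  · intro i j h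
    exact Subtype.ext (pair_eq_of_faceOf_eq (G := G.cut e) h)
  · intro i j h
    exact Subtype.ext (pair_eq_of_faceOf_eq (G := G.cut e) h)

theorem card_face_cut {e : G.Edge} {d : G.PreEdge} (hd : d ∈ e.1)
    (hb : Quot.mk (G.cut e).compRel d ≠ Quot.mk (G.cut e).compRel (G.mate d)) :
    Nat.card (G.cut e).Face = Nat.card G.Face + n := by
  refine Eq.trans ?_ (congrArg (Nat.card G.Face + ·) (card_isPoint d))
  refine Quot.card_glue (X := G.Point) (I := {t // G.IsPoint d t}) (r := (G.cut e).faceRel)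
    (r' := G.faceRel) (a := fun i => ⟨(d, i.1), i.2⟩)
    (b := fun i => ⟨(G.mate d, i.1), i.2.mate⟩) mk_cut_faceRel ?_ (faceRel_or_cut hd) ?_ ?_
  · intro i
    exact Quot.sound ⟨rfl, Or.inr rfl⟩
  · intro i j h
    exact hb (connected_of_faceOf_eq (G := G.cut e) h).symm
  · intro i j h
    exact Subtype.ext (pair_eq_of_faceOf_eq (G := G.cut e) h)

theorem Orientable.isOpen_cut_iff (hG : G.Orientable) {e : G.Edge} {d : G.PreEdge}
    (hd : d ∈ e.1)
    (hb : Quot.mk (G.cut e).compRel d ≠ Quot.mk (G.cut e).compRel (G.mate d)) (p : G.Point) :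
    ((G.cut e).faceOf p).IsOpen ↔ (G.faceOf p).IsOpen := by
  constructor
  · rintro ⟨x, hx, hm⟩
    rcases cut_mate_eq_self.1 hm with h | h
    · exact ⟨x, faceOf_of_cut hx, h⟩
    · -- the second end of the face cannot be on the cut edge, whose ends are disconnected
      obtain ⟨y, hy, hxy⟩ := (hG.cutEdges {e}).exists_boundaryAdj (G := G.cut e) ⟨x.1.1, hm⟩ x.2
      rcases cut_mate_eq_self.1 y.2 with hy' | hy'
      · obtain ⟨h1, h2, h3⟩ := hxy
        exact ⟨⟨(y.1, x.1.2), h2⟩, faceOf_of_cut (h3.symm.trans hx), hy'⟩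
      · exfalso
        have hc : Quot.mk (G.cut e).compRel x.1.1 = Quot.mk (G.cut e).compRel y.1 :=
          hxy.connected
        have hne : y.1 ≠ x.1.1 := fun h => hy (Subtype.ext h)
        rcases (mem_edge_iff e hd).1 h with h | h <;>
          rcases (mem_edge_iff e hd).1 hy' with h' | h' <;> rw [h, h'] at hc hne
        · exact hne rfl
        · exact hb hc
        · exact hb hc.symm
        · exact hne rfl
  · rintro ⟨x, hx, hm⟩
    have hd' : G.mate d ∈ e.1 := (G.mate_mem_edge e d).2 hd
    rcases faceOf_cut_cases hd hb hx with h | ⟨i, ⟨-, h⟩ | ⟨-, h⟩⟩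
    · exact ⟨x, h, cut_mate_of_halfEdge hm⟩
    · exact ⟨_, h.symm, cut_mate_of_mem hd'⟩
    · exact ⟨_, h.symm, cut_mate_of_mem hd⟩

theorem Orientable.numIntFaces_cut (hG : G.Orientable) {e : G.Edge} {d : G.PreEdge}
    (hd : d ∈ e.1)
    (hb : Quot.mk (G.cut e).compRel d ≠ Quot.mk (G.cut e).compRel (G.mate d)) :
    (G.cut e).numIntFaces = G.numIntFaces := by
  refine congrArg (· + G.discs) (Nat.card_congr (Equiv.ofBijective (fun F =>
    ⟨Quot.lift (fun p : G.Point => G.faceOf p) mk_cut_faceRel F.1, ?_⟩) ⟨?_, ?_⟩))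
  · obtain ⟨F, hF⟩ := F
    obtain ⟨p, rfl⟩ := Quot.exists_rep F
    exact fun h => hF ((hG.isOpen_cut_iff hd hb p).2 h)
  · rintro ⟨F, hF⟩ ⟨F', hF'⟩ h
    obtain ⟨p, rfl⟩ := Quot.exists_rep F
    obtain ⟨q, rfl⟩ := Quot.exists_rep F'
    have h' : G.faceOf p = G.faceOf q := congrArg Subtype.val h
    rcases faceOf_cut_cases hd hb h' with h | ⟨i, ⟨h, -⟩ | ⟨-, h⟩⟩
    · exact Subtype.ext h
    · exact absurd ⟨_, h.symm, cut_mate_of_mem hd⟩ hF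
    · exact absurd ⟨_, h.symm, cut_mate_of_mem hd⟩ hF'
  · rintro ⟨F, hF⟩
    obtain ⟨p, rfl⟩ := Quot.exists_rep F
    exact ⟨⟨(G.cut e).faceOf p, fun h => hF ((hG.isOpen_cut_iff hd hb p).1 h)⟩, rfl⟩

theorem card_face (G : StrandedGraph.{u} n) :
    Nat.card G.Face = G.numBdryEdges + Nat.card {F : G.Face // ¬ F.IsOpen} := by
  unfold numBdryEdges
  rw [← Nat.card_sum]
  exact Nat.card_congr (Equiv.sumCompl _).symm

theorem Orientable.numBdryEdges_cut (hG : G.Orientable) {e : G.Edge} {d : G.PreEdge}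
    (hd : d ∈ e.1)
    (hb : Quot.mk (G.cut e).compRel d ≠ Quot.mk (G.cut e).compRel (G.mate d)) :
    (G.cut e).numBdryEdges = G.numBdryEdges + n := by
  have h1 := card_face_cut hd hb
  rw [card_face, card_face] at h1
  have h2 : Nat.card {F : (G.cut e).Face // ¬ F.IsOpen} + G.discs =
    Nat.card {F : G.Face // ¬ F.IsOpen} + G.discs := hG.numIntFaces_cut hd hb
  omega

/-! ### The boundary graph after cutting a bridge -/

theorem BoundaryAdj.of_cut {e : G.Edge} {t : Sym2 (Fin (n + 1))} {x y : (G.cut e).HalfEdge}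
    (h : (G.cut e).BoundaryAdj t x y) (hx : G.mate x.1 = x.1) (hy : G.mate y.1 = y.1) :
    G.BoundaryAdj t ⟨x.1, hx⟩ ⟨y.1, hy⟩ := by
  obtain ⟨h1, h2, h3⟩ := h
  exact ⟨h1, h2, faceOf_of_cut h3⟩

/-- The half-edges at the ends of a cut bridge are not connected. -/
theorem eq_of_mem_edge_of_connected {e : G.Edge} {z : G.PreEdge} (hz : z ∈ e.1)
    (hb : Quot.mk (G.cut e).compRel z ≠ Quot.mk (G.cut e).compRel (G.mate z)) {w : G.PreEdge}
    (hw : w ∈ e.1) (h : Quot.mk (G.cut e).compRel w = Quot.mk (G.cut e).compRel z) : w = z := by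
  rcases (mem_edge_iff e hz).1 hw with rfl | rfl
  · rfl
  · exact absurd h.symm hb

theorem ne_mate_of_mem_edge {X : Type*} (f : G.PreEdge → X) {e : G.Edge} {d z : G.PreEdge}
    (hd : d ∈ e.1) (hb : f d ≠ f (G.mate d)) (hz : z ∈ e.1) : f z ≠ f (G.mate z) := by
  rcases (mem_edge_iff e hd).1 hz with rfl | rfl
  · exact hb
  · rw [G.mate_mate]; exact hb.symm

/-- After cutting a bridge, the half-edges adjacent in the boundary graph to one of the two new
half-edges remain connected in the boundary graph of `G`. -/
theorem Orientable.mk_bdryRel_eq (hG : G.Orientable) {e : G.Edge} {z : G.PreEdge}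
    (hz : z ∈ e.1)
    (hb : Quot.mk (G.cut e).compRel z ≠ Quot.mk (G.cut e).compRel (G.mate z))
    {S : Finset (Fin (n + 1))} {t t' : Sym2 (Fin (n + 1))} (htS : ∀ c ∈ t, c ∈ S)
    (htS' : ∀ c ∈ t', c ∈ S) {x y : {h : G.HalfEdge // G.color h.1 ∈ S}}
    (hx : (G.cut e).BoundaryAdj t ⟨z, cut_mate_of_mem hz⟩ ⟨x.1.1, cut_mate_of_halfEdge x.1.2⟩)
    (hy : (G.cut e).BoundaryAdj t' ⟨z, cut_mate_of_mem hz⟩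
      ⟨y.1.1, cut_mate_of_halfEdge y.1.2⟩) :
    Quot.mk (G.bdryRel S) x = Quot.mk (G.bdryRel S) y := by
  have hzm := G.mate_ne_of_mem_edge e hz
  let P : Set (G.cut e).HalfEdge := {h | ∃ (hm : G.mate h.1 = h.1) (hS : G.color h.1 ∈ S),
    Quot.mk (G.bdryRel S) x = Quot.mk (G.bdryRel S) ⟨⟨h.1, hm⟩, hS⟩ ∧
      Quot.mk (G.cut e).compRel h.1 = Quot.mk (G.cut e).compRel z}
  have key := (hG.cutEdges {e}).boundaryAdj_mem (G := G.cut e) S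
    (d := ⟨z, cut_mate_of_mem hz⟩) P ?_ ?_ htS htS' (x := ⟨x.1.1, cut_mate_of_halfEdge x.1.2⟩)
    (y := ⟨y.1.1, cut_mate_of_halfEdge y.1.2⟩) ?_ hx.symm hy ?_
  · obtain ⟨_, _, h, _⟩ := key
    exact h
  · rintro ⟨hm, -⟩
    exact hzm hm
  · rintro t htS x ⟨hm, hS, h, hc⟩ w hw hxw
    have hwc : Quot.mk (G.cut e).compRel w.1 = Quot.mk (G.cut e).compRel z :=
      hxw.connected.symm.trans hc
    have hwm : G.mate w.1 = w.1 := by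
      rcases cut_mate_eq_self.1 w.2 with hw' | hw'
      · exact hw'
      · exact absurd (Subtype.ext (eq_of_mem_edge_of_connected hz hb hw' hwc)) hw
    have hxw' := hxw.of_cut hm hwm
    obtain ⟨_, hwt, _⟩ := id hxw'
    exact ⟨hwm, htS _ hwt.1, h.trans (Quot.sound ⟨t, htS, hxw'⟩), hwc⟩
  · exact ⟨x.1.2, x.2, rfl, hx.connected.symm⟩
  · intro h
    have h' : y.1.1 = z := congrArg Subtype.val h
    exact hzm (h' ▸ y.1.2)

theorem Orientable.card_bdryRel_cut (hG : G.Orientable) {e : G.Edge} {d : G.PreEdge}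
    (hd : d ∈ e.1)
    (hb : Quot.mk (G.cut e).compRel d ≠ Quot.mk (G.cut e).compRel (G.mate d))
    {S : Finset (Fin (n + 1))} (hS : G.color d ∈ S) (hS2 : 2 ≤ S.card) :
    Nat.card (Quot ((G.cut e).bdryRel S)) = Nat.card (Quot (G.bdryRel S)) + 1 := by
  obtain ⟨t, hdt, htd, htS⟩ := exists_pair hS2 hS
  have hd' : G.mate d ∈ e.1 := (G.mate_mem_edge e d).2 hd
  have hbz : ∀ z ∈ e.1, Quot.mk (G.cut e).compRel z ≠ Quot.mk (G.cut e).compRel (G.mate z) :=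
    fun z hz => ne_mate_of_mem_edge (G := G) (fun x => Quot.mk (G.cut e).compRel x) hd hb hz
  -- a neighbor in the boundary graph of each of the two new half-edges
  have hex : ∀ z (hz : z ∈ e.1), ∃ y : {h : G.HalfEdge // G.color h.1 ∈ S},
      (G.cut e).BoundaryAdj t ⟨z, cut_mate_of_mem hz⟩
        ⟨y.1.1, cut_mate_of_halfEdge y.1.2⟩ := by
    intro z hz
    have hzt : G.IsPoint z t := ⟨by rw [color_of_mem_edge e hd hz]; exact hdt, htd⟩
    obtain ⟨y, hy, hzy⟩ := (hG.cutEdges {e}).exists_boundaryAdj (G := G.cut e)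
      ⟨z, cut_mate_of_mem hz⟩ hzt
    obtain ⟨_, hyt, _⟩ := id hzy
    rcases cut_mate_eq_self.1 y.2 with hy' | hy'
    · exact ⟨⟨⟨y.1, hy'⟩, htS _ hyt.1⟩, hzy⟩
    · exact absurd (Subtype.ext (eq_of_mem_edge_of_connected hz (hbz z hz) hy'
        hzy.connected.symm)) hy
  choose Y hY using hex
  let XK := {h : (G.cut e).HalfEdge // (G.cut e).color h.1 ∈ S}
  let XG := {h : G.HalfEdge // G.color h.1 ∈ S}
  let D : XK := ⟨⟨d, cut_mate_of_mem hd⟩, hS⟩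
  have hS' : G.color (G.mate d) ∈ S := by rw [G.mate_color]; exact hS
  let D' : XK := ⟨⟨G.mate d, cut_mate_of_mem hd'⟩, hS'⟩
  let r' : XK → XK → Prop := fun x y => (G.cut e).bdryRel S x y ∨ (x = D ∧ y = D')
  have hr1 : ∀ x y, (G.cut e).bdryRel S x y → Quot.mk r' x = Quot.mk r' y :=
    fun x y h => Quot.sound (r := r') (Or.inl h)
  have hDD : Quot.mk r' D = Quot.mk r' D' := Quot.sound (r := r') (Or.inr ⟨rfl, rfl⟩)
  have h1 : Nat.card (Quot ((G.cut e).bdryRel S)) = Nat.card (Quot r') + 1 := by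
    have := Quot.card_glue (X := XK) (I := Unit) (r := (G.cut e).bdryRel S) (r' := r')
      (a := fun _ => D) (b := fun _ => D') hr1 (fun _ => hDD) ?_ ?_ (fun _ _ _ => rfl)
    · rw [Nat.card_unique (α := Unit)] at this
      exact this
    · rintro x y (h | h)
      · exact Or.inl (Quot.sound h)
      · exact Or.inr ⟨(), Or.inl h⟩
    · intro _ _ h
      exact hb (connected_of_bdryRel (G := G.cut e) h).symm
  rw [h1]
  congr 1
  have hoff : ∀ x : XK, x.1.1 ∉ e.1 → G.mate x.1.1 = x.1.1 := fun x hx =>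
    (cut_mate_eq_self.1 x.1.2).resolve_right hx
  let f : XG → XK := fun x => ⟨⟨x.1.1, cut_mate_of_halfEdge x.1.2⟩, x.2⟩
  let g : XK → XG := fun x =>
    if hx : x.1.1 ∈ e.1 then Y x.1.1 hx else ⟨⟨x.1.1, hoff x hx⟩, x.2⟩
  have hg1 : ∀ x (hx : x.1.1 ∈ e.1), g x = Y x.1.1 hx := fun x hx => dif_pos hx
  have hg2 : ∀ x (hx : x.1.1 ∉ e.1), g x = ⟨⟨x.1.1, hoff x hx⟩, x.2⟩ := fun x hx => dif_neg hx
  have hfg : ∀ x, Quot.mk r' (f (g x)) = Quot.mk r' x := by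
    intro x
    by_cases hx : x.1.1 ∈ e.1
    · rw [hg1 x hx]
      exact (hr1 _ _ ⟨t, htS, hY _ hx⟩).symm
    · rw [hg2 x hx]
      rfl
  refine Quot.card_eq_of_retract g f ?_ ?_ hfg ?_
  · rintro x y (⟨t', htS', h⟩ | ⟨rfl, rfl⟩)
    · by_cases hx : x.1.1 ∈ e.1 <;> by_cases hy : y.1.1 ∈ e.1
      · have : x = y :=
          Subtype.ext (Subtype.ext (eq_of_mem_edge_of_connected hy (hbz _ hy) hx h.connected))
        rw [this]
      · rw [hg1 x hx, hg2 y hy]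
        exact hG.mk_bdryRel_eq hx (hbz _ hx) htS htS' (hY _ hx) h
      · rw [hg2 x hx, hg1 y hy]
        exact hG.mk_bdryRel_eq hy (hbz _ hy) htS' htS h.symm (hY _ hy)
      · rw [hg2 x hx, hg2 y hy]
        exact Quot.sound ⟨t', htS', h.of_cut (hoff x hx) (hoff y hy)⟩
    · rw [hg1 D hd, hg1 D' hd']
      obtain ⟨p1, p2, p3⟩ := hY _ hd
      obtain ⟨q1, q2, q3⟩ := hY _ hd'
      have hpt : G.IsPoint d t := p1
      exact Quot.sound ⟨t, htS, p2, q2,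
        (faceOf_of_cut p3).symm.trans ((faceOf_mate hpt).symm.trans (faceOf_of_cut q3))⟩
  · rintro x y ⟨t', htS', p1, p2, p3⟩
    rcases faceOf_cut_cases hd hb p3 with h | ⟨i, ⟨h, h'⟩ | ⟨h, h'⟩⟩
    · exact hr1 _ _ ⟨t', htS', p1, p2, h⟩
    · obtain ⟨i, hi⟩ := i
      obtain rfl : t' = i := pair_eq_of_faceOf_eq (G := G.cut e) h
      have h1 : Quot.mk r' (f x) = Quot.mk r' D := hr1 _ _ ⟨t', htS', p1, hi, h⟩
      have h2 : Quot.mk r' (f y) = Quot.mk r' D' :=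
        hr1 _ _ ⟨t', htS', p2, hi.mate, h'⟩
      exact h1.trans (hDD.trans h2.symm)
    · obtain ⟨i, hi⟩ := i
      obtain rfl : t' = i := pair_eq_of_faceOf_eq (G := G.cut e) h
      have h1 : Quot.mk r' (f x) = Quot.mk r' D' :=
        hr1 _ _ ⟨t', htS', p1, hi.mate, h⟩
      have h2 : Quot.mk r' (f y) = Quot.mk r' D := hr1 _ _ ⟨t', htS', p2, hi, h'⟩
      exact h1.trans (hDD.symm.trans h2.symm)
  · intro x
    have hx : (f x).1.1 ∉ e.1 := fun h => G.mate_ne_of_mem_edge e h x.1.2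
    rw [hg2 _ hx]
    rfl

theorem card_bdryRel_cut_of_notMem {e : G.Edge} {d : G.PreEdge}
    (hd : d ∈ e.1)
    (hb : Quot.mk (G.cut e).compRel d ≠ Quot.mk (G.cut e).compRel (G.mate d))
    {S : Finset (Fin (n + 1))} (hS : G.color d ∉ S) :
    Nat.card (Quot ((G.cut e).bdryRel S)) = Nat.card (Quot (G.bdryRel S)) := by
  have hoff : ∀ x : {h : (G.cut e).HalfEdge // (G.cut e).color h.1 ∈ S},
      G.mate x.1.1 = x.1.1 := fun x =>
    (cut_mate_eq_self.1 x.1.2).resolve_right fun h => hS (color_of_mem_edge e hd h ▸ x.2)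
  refine Quot.card_eq_of_retract (r := (G.cut e).bdryRel S) (r' := G.bdryRel S)
    (fun x => ⟨⟨x.1.1, hoff x⟩, x.2⟩)
    (fun x => ⟨⟨x.1.1, cut_mate_of_halfEdge x.1.2⟩, x.2⟩) ?_ ?_ (fun _ => rfl) (fun _ => rfl)
  · rintro x y ⟨t, htS, h⟩
    exact Quot.sound ⟨t, htS, h.of_cut (hoff x) (hoff y)⟩
  · rintro x y ⟨t, htS, p1, p2, p3⟩
    refine Quot.sound ⟨t, htS, p1, p2, ?_⟩
    rcases faceOf_cut_cases hd hb p3 with h | ⟨⟨i, hi⟩, ⟨h, -⟩ | ⟨h, -⟩⟩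
    · exact h
    all_goals
      obtain rfl : t = i := pair_eq_of_faceOf_eq (G := G.cut e) h
      exact absurd (htS _ hi.1) hS

theorem Orientable.numBdryComponents_cut (hn : 1 ≤ n) (hG : G.Orientable) {e : G.Edge}
    {d : G.PreEdge} (hd : d ∈ e.1)
    (hb : Quot.mk (G.cut e).compRel d ≠ Quot.mk (G.cut e).compRel (G.mate d)) :
    (G.cut e).numBdryComponents = G.numBdryComponents + 1 := by
  rw [numBdryComponents_eq, numBdryComponents_eq]
  refine hG.card_bdryRel_cut hd hb (Finset.mem_univ _) ?_
  rw [Finset.card_univ, Fintype.card_fin]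
  omega

theorem Orientable.numBdryFaces_cut (hG : G.Orientable) {e : G.Edge}
    {d : G.PreEdge} (hd : d ∈ e.1)
    (hb : Quot.mk (G.cut e).compRel d ≠ Quot.mk (G.cut e).compRel (G.mate d)) :
    (G.cut e).numBdryFaces = G.numBdryFaces + n.choose 2 :=
  sum_powersetCard_add_one (G.color d) 2 (fun S => Nat.card (Quot ((G.cut e).bdryRel S)))
    (fun S => Nat.card (Quot (G.bdryRel S)))
    (fun _ hS h => hG.card_bdryRel_cut hd hb h (by omega))
    (fun _ _ h => card_bdryRel_cut_of_notMem hd hb h)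

end StrandedGraph

/-! ### Contracting an edge that is not a loop -/

namespace StrandedGraph

variable {n : ℕ} (G : StrandedGraph.{u} n)

/-- Adjacency of pre-edges through chords. Its classes are the vertices other than the discs. -/
def chordRel (d d' : G.PreEdge) : Prop := ∃ t, G.IsPoint d t ∧ d' = G.chord t d

variable {G}

theorem exists_chordRel_ne_of_not_isLoop {e : G.Edge} (h : ¬ G.IsLoop e) :
    ∃ d ∈ e.1, Quot.mk G.chordRel d ≠ Quot.mk G.chordRel (G.mate d) := by
  unfold IsLoop at h
  push Not at h
  obtain ⟨d, hd, h⟩ := h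
  exact ⟨d, hd, fun hq => h (Quot.eqvGen_exact hq)⟩

theorem compRel_cut_of_chordRel {e : G.Edge} {x y : G.PreEdge}
    (h : Quot.mk G.chordRel x = Quot.mk G.chordRel y) :
    Quot.mk (G.cut e).compRel x = Quot.mk (G.cut e).compRel y := by
  refine Quot.apply_eq_of_mk_eq (r := G.chordRel)
    (fun x : G.PreEdge => Quot.mk (G.cut e).compRel x) ?_ h
  rintro a b ⟨t, ht, h⟩
  exact Quot.sound (Or.inl ⟨t, ht, h⟩)

theorem IsPoint.mk_chord {t : Sym2 (Fin (n + 1))} {d : G.PreEdge} (h : G.IsPoint d t) :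
    Quot.mk G.chordRel (G.chord t d) = Quot.mk G.chordRel d :=
  (Quot.sound ⟨t, h, rfl⟩).symm

/-- `e` joins pre-edges at different vertices. -/
def Joins (e : G.Edge) : Prop :=
  ∀ z ∈ e.1, Quot.mk G.chordRel z ≠ Quot.mk G.chordRel (G.mate z)

theorem joins_of_not_isLoop {e : G.Edge} (h : ¬ G.IsLoop e) : G.Joins e := by
  obtain ⟨d, hd, h⟩ := exists_chordRel_ne_of_not_isLoop h
  exact fun z hz => ne_mate_of_mem_edge (fun x => Quot.mk G.chordRel x) hd h hz

theorem Joins.eq_of_mem {e : G.Edge} (he : G.Joins e) {z w : G.PreEdge} (hz : z ∈ e.1)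
    (hw : w ∈ e.1) (h : Quot.mk G.chordRel w = Quot.mk G.chordRel z) : w = z := by
  rcases (mem_edge_iff e hz).1 hw with rfl | rfl
  · rfl
  · exact absurd h.symm (he z hz)

theorem Joins.chord_notMem {e : G.Edge} (he : G.Joins e) {z : G.PreEdge} (hz : z ∈ e.1)
    {t : Sym2 (Fin (n + 1))} (ht : G.IsPoint z t) : G.chord t z ∉ e.1 :=
  fun h => ht.chord_ne (he.eq_of_mem hz h ht.mk_chord)

theorem contractChord_of_notMem {e : G.Edge} {t : Sym2 (Fin (n + 1))}
    {x : {d : G.PreEdge // d ∉ e.1}} (h : G.chord t x.1 ∉ e.1) :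
    G.contractChord e t x = ⟨G.chord t x.1, h⟩ :=
  dif_pos h

theorem contractChord_of_mem {e : G.Edge} {t : Sym2 (Fin (n + 1))}
    {x : {d : G.PreEdge // d ∉ e.1}} (hx : G.IsPoint x.1 t) (h : G.chord t x.1 ∈ e.1) :
    (G.contractChord e t x).1 = G.chord t (G.mate (G.chord t x.1)) := by
  rcases G.contractChord_cases e t x hx.1 hx.2 with ⟨h', _⟩ | ⟨_, _, h'⟩
  · exact absurd h h'
  · exact h'

/-- The chord in `t` at one end of `e` is joined through the strand of `e` to the chord at the other
end. -/
theorem Joins.contractChord_chord {e : G.Edge} (he : G.Joins e) {z : G.PreEdge} (hz : z ∈ e.1)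
    {t : Sym2 (Fin (n + 1))} (ht : G.IsPoint z t) :
    (G.contractChord e t ⟨G.chord t z, he.chord_notMem hz ht⟩).1 = G.chord t (G.mate z) := by
  have h : G.chord t (G.chord t z) = z := ht.chord_chord
  rw [contractChord_of_mem ht.chord (by rw [h]; exact hz), h]

/-! ### Bubbles and components after a contraction -/

theorem Orientable.card_bubbleRel_contract (hG : G.Orientable) {e : G.Edge} (he : G.Joins e)
    {S : Finset (Fin (n + 1))} (hS2 : 2 ≤ S.card) :
    Nat.card (Quot ((G.contract e).bubbleRel S)) = Nat.card (Quot (G.bubbleRel S)) := by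
  obtain ⟨d, hd⟩ : ∃ d, d ∈ e.1 := by
    obtain ⟨d, -, h⟩ := e.2
    exact ⟨d, by rw [h]; exact Sym2.mem_mk_left _ _⟩
  let XC := {x : (G.contract e).PreEdge // (G.contract e).color x ∈ S}
  let XG := {x : G.PreEdge // G.color x ∈ S}
  let r : XC → XC → Prop := (G.contract e).bubbleRel S
  let f : XC → XG := fun x => ⟨x.1.1, x.2⟩
  have hf : ∀ x y, r x y → Quot.mk (G.bubbleRel S) (f x) = Quot.mk (G.bubbleRel S) (f y) := by
    rintro x y (⟨t, ht, htS, h⟩ | h)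
    · have hp : G.IsPoint x.1.1 t := ht
      have h' : y.1.1 = (G.contractChord e t x.1).1 := congrArg Subtype.val h
      by_cases hx : G.chord t x.1.1 ∈ e.1
      · rw [contractChord_of_mem hp hx] at h'
        have h1 : Quot.mk (G.bubbleRel S) (f x) =
            Quot.mk (G.bubbleRel S) ⟨G.chord t x.1.1, htS _ hp.chord.1⟩ :=
          Quot.sound (Or.inl ⟨t, hp, htS, rfl⟩)
        have h2 : Quot.mk (G.bubbleRel S) ⟨G.chord t x.1.1, htS _ hp.chord.1⟩ =
            Quot.mk (G.bubbleRel S) ⟨G.mate (G.chord t x.1.1), htS _ hp.chord.mate.1⟩ :=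
          Quot.sound (Or.inr rfl)
        exact h1.trans (h2.trans (Quot.sound (Or.inl ⟨t, hp.chord.mate, htS, h'⟩)))
      · rw [contractChord_of_notMem hx] at h'
        exact Quot.sound (Or.inl ⟨t, hp, htS, h'⟩)
    · exact Quot.sound (Or.inr (congrArg Subtype.val h))
  -- steps that do not meet the edge
  have hoff : ∀ x y : XC, G.bubbleRel S (f x) (f y) → Quot.mk r x = Quot.mk r y := by
    rintro ⟨x, hx⟩ ⟨y, hy⟩ (⟨t, ht, htS, h⟩ | h)
    · refine Quot.sound (Or.inl ⟨t, ht, htS, ?_⟩)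
      have h' : y.1 = G.chord t x.1 := h
      have hx' : G.chord t x.1 ∉ e.1 := h' ▸ y.2
      exact (Subtype.ext h').trans (contractChord_of_notMem hx').symm
    · exact Quot.sound (Or.inr (Subtype.ext h))
  by_cases hS : G.color d ∈ S
  · obtain ⟨t, hdt, htd, htS⟩ := exists_pair hS2 hS
    have hpt : ∀ z ∈ e.1, G.IsPoint z t := fun z hz =>
      ⟨by rw [color_of_mem_edge e hd hz]; exact hdt, htd⟩
    let Y : ∀ z ∈ e.1, ∀ t, G.IsPoint z t → (∀ c ∈ t, c ∈ S) → XC := fun z hz t ht htS =>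
      ⟨⟨G.chord t z, he.chord_notMem hz ht⟩, htS _ ht.chord.1⟩
    -- the neighbors of one end of the edge stay connected after its removal
    have hY : ∀ z (hz : z ∈ e.1) t' (ht' : G.IsPoint z t') (htS' : ∀ c ∈ t', c ∈ S),
        Quot.mk r (Y z hz t (hpt z hz) htS) = Quot.mk r (Y z hz t' ht' htS') := by
      intro z hz t' ht' htS'
      obtain ⟨hy, hyS, h, -⟩ := hG.chord_mem S (d := z) {y | ∃ (hy : y ∉ e.1)
        (hyS : G.color y ∈ S), Quot.mk r (Y z hz t (hpt z hz) htS) = Quot.mk r ⟨⟨y, hy⟩, hyS⟩ ∧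
          Quot.mk G.chordRel y = Quot.mk G.chordRel z} (fun ⟨h, _⟩ => h hz) (by
        rintro s hs x ⟨hx, hxS, h, hc⟩ hxs hne
        have hc' := hxs.mk_chord.trans hc
        have hxe : G.chord s x ∉ e.1 := fun h => hne (he.eq_of_mem hz h hc')
        exact ⟨hxe, hs _ hxs.chord.1,
          h.trans (hoff ⟨⟨x, hx⟩, hxS⟩ ⟨⟨G.chord s x, hxe⟩, hs _ hxs.chord.1⟩
            (Or.inl ⟨s, hxs, hs, rfl⟩)), hc'⟩) (hpt z hz) ht' htS htS'
        ⟨he.chord_notMem hz (hpt z hz), htS _ (hpt z hz).chord.1, rfl, (hpt z hz).mk_chord⟩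
      exact h
    let g : XG → XC := fun x =>
      if hx : x.1 ∈ e.1 then Y x.1 hx t (hpt _ hx) htS else ⟨⟨x.1, hx⟩, x.2⟩
    have hg1 : ∀ x (hx : x.1 ∈ e.1), g x = Y x.1 hx t (hpt _ hx) htS := fun x hx => dif_pos hx
    have hg2 : ∀ x (hx : x.1 ∉ e.1), g x = ⟨⟨x.1, hx⟩, x.2⟩ := fun x hx => dif_neg hx
    refine Quot.card_eq_of_retract f g hf ?_ ?_ ?_
    · rintro x y (⟨t', ht', htS', h⟩ | h)
      · by_cases hx : x.1 ∈ e.1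
        · have hy : y.1 ∉ e.1 := by rw [h]; exact he.chord_notMem hx ht'
          rw [hg1 x hx, hg2 y hy, hY _ hx t' ht' htS']
          congr 1
          exact Subtype.ext (Subtype.ext h.symm)
        · by_cases hy : y.1 ∈ e.1
          · have hyp : G.IsPoint y.1 t' := by rw [h]; exact ht'.chord
            rw [hg1 y hy, hg2 x hx, hY _ hy t' hyp htS']
            congr 1
            refine Subtype.ext (Subtype.ext ?_)
            show x.1 = G.chord t' y.1
            rw [h, ht'.chord_chord]
          · rw [hg2 x hx, hg2 y hy]
            exact hoff _ _ (Or.inl ⟨t', ht', htS', h⟩)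
      · by_cases hx : x.1 ∈ e.1
        · have hy : y.1 ∈ e.1 := by rw [h]; exact (G.mate_mem_edge e _).2 hx
          rw [hg1 x hx, hg1 y hy]
          refine Quot.sound (Or.inl ⟨t, (hpt _ hx).chord, htS, Subtype.ext ?_⟩)
          refine Eq.trans ?_ (he.contractChord_chord hx (hpt _ hx)).symm
          exact congrArg (G.chord t) h
        · have hy : y.1 ∉ e.1 := by rw [h]; exact fun h => hx ((G.mate_mem_edge e _).1 h)
          rw [hg2 x hx, hg2 y hy]
          exact hoff _ _ (Or.inr h)
    · intro x
      rw [hg2 (f x) x.1.2]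
      rfl
    · intro x
      by_cases hx : x.1 ∈ e.1
      · rw [hg1 x hx]
        exact (Quot.sound (r := G.bubbleRel S) (Or.inl ⟨t, hpt _ hx, htS, rfl⟩)).symm
      · rw [hg2 x hx]
  · have hxe : ∀ x : XG, x.1 ∉ e.1 := fun x hx => hS (color_of_mem_edge e hd hx ▸ x.2)
    exact Quot.card_eq_of_retract f (fun x => ⟨⟨x.1, hxe x⟩, x.2⟩) hf
      (fun x y h => hoff _ _ h) (fun _ => rfl) (fun _ => rfl)

theorem Joins.inner_eq_zero {e : G.Edge} (he : G.Joins e) : G.inner e = 0 := by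
  unfold inner
  rw [Nat.card_eq_zero]
  left
  refine ⟨?_⟩
  rintro ⟨t, d, hd, ht, h⟩
  exact he.chord_notMem hd ht (by rw [h]; exact (G.mate_mem_edge e d).2 hd)

theorem Joins.discs_contract {e : G.Edge} (he : G.Joins e) : (G.contract e).discs = G.discs := by
  show G.discs + G.inner e = G.discs
  rw [he.inner_eq_zero, add_zero]

theorem Orientable.numBubbles_contract (hG : G.Orientable) {e : G.Edge} (he : G.Joins e) {p : ℕ}
    (hp : 2 ≤ p) : (G.contract e).numBubbles p = G.numBubbles p := by
  refine Finset.sum_congr rfl fun S hS => ?_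
  rw [Finset.mem_powersetCard_univ] at hS
  exact hG.card_bubbleRel_contract he (hS ▸ hp)

theorem Orientable.numComponents_contract (hn : 1 ≤ n) (hG : G.Orientable) {e : G.Edge}
    (he : G.Joins e) : (G.contract e).numComponents = G.numComponents := by
  rw [numComponents_eq, numComponents_eq, hG.card_bubbleRel_contract he, he.discs_contract]
  rw [Finset.card_univ, Fintype.card_fin]
  omega

/-! ### Faces and the boundary graph after a contraction -/

theorem faceOf_of_contract {e : G.Edge} {x y : (G.contract e).Point}
    (h : (G.contract e).faceOf x = (G.contract e).faceOf y) :
    G.faceOf ⟨(x.1.1.1, x.1.2), x.2⟩ = G.faceOf ⟨(y.1.1.1, y.1.2), y.2⟩ := by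
  refine Quot.apply_eq_of_mk_eq (r := (G.contract e).faceRel)
    (fun x : (G.contract e).Point => G.faceOf ⟨(x.1.1.1, x.1.2), x.2⟩) ?_ h
  rintro ⟨⟨x, t⟩, hx⟩ ⟨⟨y, t'⟩, hy⟩ ⟨rfl, h | h⟩
  · have hp : G.IsPoint x.1 t' := hx
    have h' : y.1 = (G.contractChord e t' x).1 := congrArg Subtype.val h
    by_cases hxe : G.chord t' x.1 ∈ e.1
    · rw [contractChord_of_mem hp hxe] at h'
      refine (faceOf_chord hp).symm.trans ((faceOf_mate hp.chord).symm.trans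
        ((faceOf_chord hp.chord.mate).symm.trans ?_))
      exact congrArg G.faceOf (Subtype.ext (Prod.ext h'.symm rfl))
    · rw [contractChord_of_notMem hxe] at h'
      exact Quot.sound ⟨rfl, Or.inl h'⟩
  · exact Quot.sound ⟨rfl, Or.inr (congrArg Subtype.val h)⟩

/-- The points of `G` moved off the edge `e` along the chords. -/
noncomputable def Joins.pushOff {e : G.Edge} (he : G.Joins e) (p : G.Point) :
    (G.contract e).Point :=
  if h : p.1.1 ∈ e.1 then
    ⟨(⟨G.chord p.1.2 p.1.1, he.chord_notMem h p.2⟩, p.1.2), IsPoint.chord p.2⟩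
  else ⟨(⟨p.1.1, h⟩, p.1.2), p.2⟩

theorem Joins.pushOff_of_mem {e : G.Edge} (he : G.Joins e) {x : G.PreEdge}
    {t : Sym2 (Fin (n + 1))} (hx : G.IsPoint x t) (h : x ∈ e.1) :
    he.pushOff ⟨(x, t), hx⟩ = ⟨(⟨G.chord t x, he.chord_notMem h hx⟩, t), IsPoint.chord hx⟩ :=
  dif_pos h

theorem Joins.pushOff_of_notMem {e : G.Edge} (he : G.Joins e) {x : G.PreEdge}
    {t : Sym2 (Fin (n + 1))} (hx : G.IsPoint x t) (h : x ∉ e.1) :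
    he.pushOff ⟨(x, t), hx⟩ = ⟨(⟨x, h⟩, t), hx⟩ :=
  dif_neg h

theorem Joins.faceOf_pushOff {e : G.Edge} (he : G.Joins e) {p q : G.Point}
    (h : G.faceOf p = G.faceOf q) :
    (G.contract e).faceOf (he.pushOff p) = (G.contract e).faceOf (he.pushOff q) := by
  refine Quot.apply_eq_of_mk_eq (r := G.faceRel)
    (fun p => (G.contract e).faceOf (he.pushOff p)) ?_ h
  rintro ⟨⟨x, t⟩, hx⟩ ⟨⟨y, t'⟩, hy⟩ ⟨rfl, h | h⟩
  · dsimp only at h hx hy ⊢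
    have hx' : G.IsPoint x t' := hx
    by_cases hxe : x ∈ e.1
    · have hye : y ∉ e.1 := by rw [h]; exact he.chord_notMem hxe hx
      rw [he.pushOff_of_mem hx hxe, he.pushOff_of_notMem hy hye]
      exact congrArg (G.contract e).faceOf (Subtype.ext (Prod.ext (Subtype.ext h.symm) rfl))
    · by_cases hye : y ∈ e.1
      · rw [he.pushOff_of_notMem hx hxe, he.pushOff_of_mem hy hye]
        refine congrArg (G.contract e).faceOf (Subtype.ext (Prod.ext (Subtype.ext ?_) rfl))
        show x = G.chord t' y
        rw [h, hx'.chord_chord]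
      · rw [he.pushOff_of_notMem hx hxe, he.pushOff_of_notMem hy hye]
        have hxe' : G.chord t' x ∉ e.1 := h ▸ hye
        exact Quot.sound ⟨rfl, Or.inl ((Subtype.ext h).trans
          (contractChord_of_notMem (x := ⟨x, hxe⟩) hxe').symm)⟩
  · dsimp only at h hx hy ⊢
    have hx' : G.IsPoint x t' := hx
    by_cases hxe : x ∈ e.1
    · have hye : y ∈ e.1 := by rw [h]; exact (G.mate_mem_edge e _).2 hxe
      rw [he.pushOff_of_mem hx hxe, he.pushOff_of_mem hy hye]
      refine Quot.sound ⟨rfl, Or.inl (Subtype.ext ?_)⟩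
      exact (congrArg (G.chord t') h).trans (he.contractChord_chord hxe hx').symm
    · have hye : y ∉ e.1 := by rw [h]; exact fun h => hxe ((G.mate_mem_edge e _).1 h)
      rw [he.pushOff_of_notMem hx hxe, he.pushOff_of_notMem hy hye]
      exact Quot.sound ⟨rfl, Or.inr (Subtype.ext h)⟩

theorem Joins.faceOf_contract_iff {e : G.Edge} (he : G.Joins e) {x y : (G.contract e).Point} :
    (G.contract e).faceOf x = (G.contract e).faceOf y ↔
      G.faceOf ⟨(x.1.1.1, x.1.2), x.2⟩ = G.faceOf ⟨(y.1.1.1, y.1.2), y.2⟩ := by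
  refine ⟨faceOf_of_contract, fun h => ?_⟩
  have h := he.faceOf_pushOff h
  have hp : ∀ x : (G.contract e).Point, he.pushOff ⟨(x.1.1.1, x.1.2), x.2⟩ = x :=
    fun x => dif_neg x.1.1.2
  rwa [hp, hp] at h

theorem Joins.exists_faceOf_eq {e : G.Edge} (he : G.Joins e) (p : G.Point) :
    ∃ x : (G.contract e).Point, G.faceOf ⟨(x.1.1.1, x.1.2), x.2⟩ = G.faceOf p := by
  refine ⟨he.pushOff p, ?_⟩
  by_cases h : p.1.1 ∈ e.1
  · have : he.pushOff p = _ := dif_pos h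
    rw [this]
    exact faceOf_chord p.2
  · have : he.pushOff p = _ := dif_neg h
    rw [this]
    rfl

theorem notMem_edge_of_halfEdge (e : G.Edge) {x : G.PreEdge} (hx : G.mate x = x) : x ∉ e.1 :=
  fun h => G.mate_ne_of_mem_edge e h hx

theorem Joins.isOpen_contract_iff {e : G.Edge} (he : G.Joins e) (x : (G.contract e).Point) :
    ((G.contract e).faceOf x).IsOpen ↔ (G.faceOf ⟨(x.1.1.1, x.1.2), x.2⟩).IsOpen := by
  constructor
  · rintro ⟨y, hy, hm⟩
    exact ⟨_, faceOf_of_contract hy, congrArg Subtype.val hm⟩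
  · rintro ⟨y, hy, hm⟩
    exact ⟨⟨(⟨y.1.1, notMem_edge_of_halfEdge e hm⟩, y.1.2), y.2⟩,
      he.faceOf_contract_iff.2 hy, Subtype.ext hm⟩

/-- Contraction of an edge that joins two vertices preserves the faces, open or closed. -/
theorem Joins.exists_face_equiv {e : G.Edge} (he : G.Joins e) :
    ∃ φ : (G.contract e).Face ≃ G.Face, ∀ F, F.IsOpen ↔ (φ F).IsOpen := by
  let φ : (G.contract e).Face → G.Face := Quot.lift
    (fun x : (G.contract e).Point => G.faceOf ⟨(x.1.1.1, x.1.2), x.2⟩)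
    fun a b h => faceOf_of_contract (Quot.sound h)
  refine ⟨Equiv.ofBijective φ ⟨?_, ?_⟩, ?_⟩
  · rintro ⟨x⟩ ⟨y⟩ h
    exact he.faceOf_contract_iff.2 h
  · rintro ⟨p⟩
    obtain ⟨x, hx⟩ := he.exists_faceOf_eq p
    exact ⟨(G.contract e).faceOf x, hx⟩
  · rintro ⟨x⟩
    exact he.isOpen_contract_iff x

theorem Joins.numIntFaces_contract {e : G.Edge} (he : G.Joins e) :
    (G.contract e).numIntFaces = G.numIntFaces := by
  obtain ⟨φ, hφ⟩ := he.exists_face_equiv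
  exact congrArg₂ (· + ·) (Nat.card_congr (φ.subtypeEquiv fun F => not_congr (hφ F)))
    he.discs_contract

theorem Joins.numBdryEdges_contract {e : G.Edge} (he : G.Joins e) :
    (G.contract e).numBdryEdges = G.numBdryEdges := by
  obtain ⟨φ, hφ⟩ := he.exists_face_equiv
  exact Nat.card_congr (φ.subtypeEquiv hφ)

/-- The half-edges are not affected by a contraction. -/
def contractHalfEdge (e : G.Edge) : (G.contract e).HalfEdge ≃ G.HalfEdge where
  toFun h := ⟨h.1.1, congrArg Subtype.val h.2⟩
  invFun h := ⟨⟨h.1, notMem_edge_of_halfEdge e h.2⟩, Subtype.ext h.2⟩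
  left_inv _ := rfl
  right_inv _ := rfl

theorem numHalfEdges_contract (e : G.Edge) : (G.contract e).numHalfEdges = G.numHalfEdges :=
  Nat.card_congr (contractHalfEdge e)

theorem Joins.boundaryAdj_contract_iff {e : G.Edge} (he : G.Joins e) {t : Sym2 (Fin (n + 1))}
    {x y : (G.contract e).HalfEdge} :
    (G.contract e).BoundaryAdj t x y ↔
      G.BoundaryAdj t (contractHalfEdge e x) (contractHalfEdge e y) :=
  ⟨fun ⟨h1, h2, h3⟩ => ⟨h1, h2, he.faceOf_contract_iff.1 h3⟩,
    fun ⟨h1, h2, h3⟩ => ⟨h1, h2, he.faceOf_contract_iff.2 h3⟩⟩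

theorem Joins.card_bdryRel_contract {e : G.Edge} (he : G.Joins e) (S : Finset (Fin (n + 1))) :
    Nat.card (Quot ((G.contract e).bdryRel S)) = Nat.card (Quot (G.bdryRel S)) := by
  refine Quot.card_eq_of_retract (r := (G.contract e).bdryRel S) (r' := G.bdryRel S)
    (fun x => ⟨contractHalfEdge e x.1, x.2⟩) (fun x => ⟨(contractHalfEdge e).symm x.1, x.2⟩)
    ?_ ?_ (fun _ => rfl) (fun _ => rfl)
  · rintro x y ⟨t, ht, h⟩
    exact Quot.sound ⟨t, ht, he.boundaryAdj_contract_iff.1 h⟩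
  · rintro x y ⟨t, ht, h⟩
    exact Quot.sound ⟨t, ht, he.boundaryAdj_contract_iff.2 h⟩

theorem Joins.numBdryComponents_contract {e : G.Edge} (he : G.Joins e) :
    (G.contract e).numBdryComponents = G.numBdryComponents := by
  rw [numBdryComponents_eq, numBdryComponents_eq, he.card_bdryRel_contract]

theorem Joins.numBdryFaces_contract {e : G.Edge} (he : G.Joins e) :
    (G.contract e).numBdryFaces = G.numBdryFaces :=
  Finset.sum_congr rfl fun S _ => he.card_bdryRel_contract S

end StrandedGraph

/-! ### Spanning subgraphs of cut and contracted graphs -/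

namespace StrandedGraph

variable {n : ℕ} {G : StrandedGraph.{u} n}

theorem edge_val_eq (a : G.Edge) {x : G.PreEdge} (hx : x ∈ a.1) : a.1 = s(x, G.mate x) := by
  obtain ⟨d, -, h⟩ := a.2
  rw [h] at hx ⊢
  rcases Sym2.mem_iff.1 hx with rfl | rfl
  · rfl
  · rw [G.mate_mate, Sym2.eq_swap]

theorem edge_eq_of_mem {a b : G.Edge} {x : G.PreEdge} (ha : x ∈ a.1) (hb : x ∈ b.1) : a = b :=
  Subtype.ext ((edge_val_eq a ha).trans (edge_val_eq b hb).symm)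

theorem exists_mem_edge (e : G.Edge) : ∃ d, d ∈ e.1 := by
  obtain ⟨d, -, h⟩ := e.2
  exact ⟨d, by rw [h]; exact Sym2.mem_mk_left _ _⟩

theorem spanning_mate_of_mem {A : Set G.Edge} {e : G.Edge} (he : e ∈ A) {d : G.PreEdge}
    (hd : d ∈ e.1) : (G.spanning A).mate d = G.mate d :=
  if_neg fun ⟨_, hb, hdb⟩ => hb (edge_eq_of_mem hd hdb ▸ he)

theorem spanning_mate_of_notMem {A : Set G.Edge} {d : G.PreEdge} (h : ∀ a ∈ A, d ∉ a.1) :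
    (G.spanning A).mate d = d := by
  by_cases h' : ∃ a ∈ Aᶜ, d ∈ a.1
  · exact if_pos h'
  · refine (if_neg h').trans ?_
    by_contra hm
    by_cases ha : (⟨s(d, G.mate d), d, hm, rfl⟩ : G.Edge) ∈ A
    · exact h _ ha (Sym2.mem_mk_left _ _)
    · exact h' ⟨_, ha, Sym2.mem_mk_left _ _⟩

theorem spanning_mate_or (A : Set G.Edge) (x : G.PreEdge) :
    (G.spanning A).mate x = x ∨ (G.spanning A).mate x = G.mate x := by
  by_cases h : ∃ a ∈ A, x ∈ a.1
  · obtain ⟨a, ha, hx⟩ := h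
    exact Or.inr (spanning_mate_of_mem ha hx)
  · exact Or.inl (spanning_mate_of_notMem fun a ha hx => h ⟨a, ha, hx⟩)

theorem eq_of_fields {P : Type u} {fin : Finite P} {col : P → Fin (n + 1)}
    {ch ch' : Sym2 (Fin (n + 1)) → P → P} {m m' : P → P} {k k' : ℕ} {h1 h2 h3 h4 h5}
    {h1' h2' h3' h4' h5'} (hch : ch = ch') (hm : m = m') (hk : k = k') :
    (⟨P, fin, col, ch, h1, h2, h3, m, h4, h5, k⟩ : StrandedGraph.{u} n) =
      ⟨P, fin, col, ch', h1', h2', h3', m', h4', h5', k'⟩ := by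
  subst hch hm hk
  rfl

theorem Orientable.spanning (hG : G.Orientable) (A : Set G.Edge) : (G.spanning A).Orientable :=
  hG.cutEdges Aᶜ

/-- An edge of `G` that is kept in a spanning subgraph. -/
def spanningEdge {A : Set G.Edge} {e : G.Edge} (he : e ∈ A) : (G.spanning A).Edge :=
  ⟨e.1, by
    obtain ⟨d, hd⟩ := exists_mem_edge e
    have hm : (G.spanning A).mate d = G.mate d := spanning_mate_of_mem he hd
    refine ⟨d, ?_, ?_⟩
    · rw [hm]; exact G.mate_ne_of_mem_edge e hd
    · rw [hm]; exact edge_val_eq e hd⟩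

theorem cut_spanning_eq {e : G.Edge} {B : Set (G.cut e).Edge} {A : Set G.Edge} (he : e ∉ A)
    (hAB : ∀ x : G.PreEdge, (∃ b ∈ B, x ∈ b.1) ↔ ∃ a ∈ A, x ∈ a.1) :
    (G.cut e).spanning B = G.spanning A := by
  refine eq_of_fields rfl (funext fun x : G.PreEdge => ?_) rfl
  show ((G.cut e).spanning B).mate x = (G.spanning A).mate x
  by_cases h : ∃ a ∈ A, x ∈ a.1
  · obtain ⟨b, hb, hxb⟩ := (hAB x).2 h
    obtain ⟨a, ha, hx⟩ := h
    rw [spanning_mate_of_mem ha hx]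
    exact (spanning_mate_of_mem (G := G.cut e) hb hxb).trans
      (cut_mate_of_notMem fun hxe => he (edge_eq_of_mem hx hxe ▸ ha))
  · rw [spanning_mate_of_notMem fun a ha hx => h ⟨a, ha, hx⟩]
    exact spanning_mate_of_notMem (G := G.cut e) fun b hb hx => h ((hAB x).1 ⟨b, hb, hx⟩)

theorem spanning_cut_eq {A : Set G.Edge} {e : G.Edge} (he : e ∉ A) :
    (G.spanning (insert e A)).cut (spanningEdge (Set.mem_insert e A)) = G.spanning A := by
  refine eq_of_fields rfl (funext fun x : G.PreEdge => ?_) rfl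
  show ((G.spanning (insert e A)).cut (spanningEdge (Set.mem_insert e A))).mate x =
    (G.spanning A).mate x
  by_cases hx : x ∈ e.1
  · rw [spanning_mate_of_notMem fun a ha hxa => he (edge_eq_of_mem hxa hx ▸ ha)]
    exact cut_mate_of_mem (G := G.spanning (insert e A)) hx
  · refine (cut_mate_of_notMem (G := G.spanning (insert e A)) hx).trans ?_
    by_cases h : ∃ a ∈ A, x ∈ a.1
    · obtain ⟨a, ha, hxa⟩ := h
      rw [spanning_mate_of_mem ha hxa, spanning_mate_of_mem (Set.mem_insert_of_mem e ha) hxa]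
    · rw [spanning_mate_of_notMem fun a ha hx => h ⟨a, ha, hx⟩, spanning_mate_of_notMem]
      rintro a (rfl | ha) hxa
      · exact hx hxa
      · exact h ⟨a, ha, hxa⟩

/-- Contractions and spanning subgraphs commute. -/
theorem spanning_contract_eq {e : G.Edge} {A : Set G.Edge} (he : e ∈ A)
    {B : Set (G.contract e).Edge}
    (hAB : ∀ x : (G.contract e).PreEdge, (∃ b ∈ B, x ∈ b.1) ↔ ∃ a ∈ A, x.1 ∈ a.1) :
    (G.spanning A).contract (spanningEdge he) = (G.contract e).spanning B := by
  refine eq_of_fields (funext fun t => funext fun x : {x : G.PreEdge // x ∉ e.1} => ?_)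
    (funext fun x : {x : G.PreEdge // x ∉ e.1} => ?_) ?_
  · show (G.spanning A).contractChord (spanningEdge he) t x = G.contractChord e t x
    by_cases h : G.chord t x.1 ∈ e.1
    · have hm : (G.spanning A).mate (G.chord t x.1) = G.mate (G.chord t x.1) :=
        spanning_mate_of_mem he h
      have hm' := congrArg (G.chord t) hm
      by_cases h' : G.chord t (G.mate (G.chord t x.1)) ∈ e.1
      · refine Eq.trans ((dif_neg (not_not.2 h)).trans (dif_neg (not_not.2 ?_)))
          ((dif_neg (not_not.2 h)).trans (dif_neg (not_not.2 h'))).symm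
        exact hm'.symm ▸ h'
      · refine Eq.trans ((dif_neg (not_not.2 h)).trans ((dif_pos ?_).trans (Subtype.ext ?_)))
          ((dif_neg (not_not.2 h)).trans (dif_pos h')).symm
        · exact hm'.symm ▸ h'
        · exact hm'
    · exact (dif_pos h).trans (dif_pos h).symm
  · refine Subtype.ext ?_
    show (G.spanning A).mate x.1 = (((G.contract e).spanning B).mate x).1
    by_cases h : ∃ a ∈ A, x.1 ∈ a.1
    · obtain ⟨b, hb, hxb⟩ := (hAB x).2 h
      obtain ⟨a, ha, hx⟩ := h
      rw [spanning_mate_of_mem ha hx]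
      exact congrArg Subtype.val (spanning_mate_of_mem (G := G.contract e) hb hxb).symm
    · rw [spanning_mate_of_notMem fun a ha hx => h ⟨a, ha, hx⟩]
      exact congrArg Subtype.val (spanning_mate_of_notMem (G := G.contract e)
        fun b hb hx => h ((hAB x).1 ⟨b, hb, hx⟩)).symm
  · show G.discs + (G.spanning A).inner (spanningEdge he) = G.discs + G.inner e
    congr 1
    unfold inner
    refine Nat.card_congr (Equiv.subtypeEquivRight fun t => ?_)
    refine exists_congr fun d => and_congr_right fun hd => and_congr_right fun _ => ?_
    show G.chord t d = (G.spanning A).mate d ↔ _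
    rw [spanning_mate_of_mem he hd]

/-! ### Edges of cut and contracted graphs -/

theorem exists_cut_edge_equiv (e : G.Edge) :
    ∃ φ : (G.cut e).Edge ≃ {a : G.Edge // a ≠ e}, ∀ b, (φ b).1.1 = b.1 := by
  have h1 : ∀ b : (G.cut e).Edge, ∃ a : {a : G.Edge // a ≠ e}, a.1.1 = b.1 := by
    rintro ⟨_, x, hx, rfl⟩
    have hxe : x ∉ e.1 := fun h => hx (cut_mate_of_mem h)
    have hm : (G.cut e).mate x = G.mate x := cut_mate_of_notMem hxe
    refine ⟨⟨⟨s(x, G.mate x), x, fun h => hx (hm.trans h), rfl⟩, fun h => hxe ?_⟩,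
      congrArg (s(x, ·)) hm.symm⟩
    rw [← h]
    exact Sym2.mem_mk_left _ _
  choose f hf using h1
  refine ⟨Equiv.ofBijective f ⟨?_, ?_⟩, hf⟩
  · intro b b' h
    exact Subtype.ext ((hf b).symm.trans ((congrArg (fun a => a.1.1) h).trans (hf b')))
  · rintro ⟨⟨_, x, hx, rfl⟩, hae⟩
    have hxe : x ∉ e.1 := fun h => hae (edge_eq_of_mem (Sym2.mem_mk_left _ _) h)
    have hm := cut_mate_of_notMem hxe
    exact ⟨⟨s(x, G.mate x), x, fun h => hx (hm.symm.trans h), by rw [hm]⟩,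
      Subtype.ext (Subtype.ext (hf _))⟩

theorem exists_contract_edge_equiv (e : G.Edge) :
    ∃ φ : (G.contract e).Edge ≃ {a : G.Edge // a ≠ e},
      ∀ b, (φ b).1.1 = b.1.map Subtype.val := by
  have h1 : ∀ b : (G.contract e).Edge, ∃ a : {a : G.Edge // a ≠ e},
      a.1.1 = b.1.map Subtype.val := by
    rintro ⟨_, x, hx, rfl⟩
    refine ⟨⟨⟨s(x.1, G.mate x.1), x.1, fun h => hx (Subtype.ext h), rfl⟩, fun h => x.2 ?_⟩, rfl⟩
    have h' : s(x.1, G.mate x.1) = e.1 := congrArg Subtype.val h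
    exact (congrArg (fun z : Sym2 G.PreEdge => x.1 ∈ z) h').mp (Sym2.mem_mk_left _ _)
  choose f hf using h1
  refine ⟨Equiv.ofBijective f ⟨?_, ?_⟩, hf⟩
  · intro b b' h
    refine Subtype.ext (Sym2.map.injective Subtype.val_injective ?_)
    exact (hf b).symm.trans ((congrArg (fun a => a.1.1) h).trans (hf b'))
  · rintro ⟨⟨_, x, hx, rfl⟩, hae⟩
    have hxe : x ∉ e.1 := fun h => hae (edge_eq_of_mem (Sym2.mem_mk_left _ _) h)
    have hme : G.mate x ∉ e.1 := fun h => hxe ((G.mate_mem_edge e x).1 h)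
    exact ⟨⟨s(⟨x, hxe⟩, ⟨G.mate x, hme⟩), ⟨x, hxe⟩, fun h => hx (congrArg Subtype.val h), rfl⟩,
      Subtype.ext (Subtype.ext (hf _))⟩

theorem card_edge_ne (e : G.Edge) : Nat.card {a : G.Edge // a ≠ e} + 1 = G.numEdges := by
  rw [← Finite.card_option]
  exact Nat.card_congr (Equiv.optionSubtypeNe e)

theorem numEdges_cut (e : G.Edge) : (G.cut e).numEdges + 1 = G.numEdges := by
  obtain ⟨φ, -⟩ := exists_cut_edge_equiv e
  rw [← card_edge_ne e, ← Nat.card_congr φ]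
  rfl

theorem numEdges_contract (e : G.Edge) : (G.contract e).numEdges + 1 = G.numEdges := by
  obtain ⟨φ, -⟩ := exists_contract_edge_equiv e
  rw [← card_edge_ne e, ← Nat.card_congr φ]
  rfl

/-! ### Vertices and rank -/

theorem numComponents_le_numVertices (G : StrandedGraph.{u} n) :
    G.numComponents ≤ G.numVertices := by
  refine Nat.add_le_add_right (Nat.card_le_card_of_surjective
    (Quot.map (ra := G.chordRel) (rb := G.compRel) id fun _ _ h => Or.inl h) ?_) _
  rintro ⟨x⟩
  exact ⟨Quot.mk _ x, rfl⟩

theorem numComponents_le_spanning (A : Set G.Edge) :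
    G.numComponents ≤ (G.spanning A).numComponents := by
  refine Nat.add_le_add_right (Nat.card_le_card_of_surjective
    (Quot.lift (r := (G.spanning A).compRel) (fun x : G.PreEdge => Quot.mk G.compRel x) ?_) ?_) _
  · rintro x y (⟨t, ht, h⟩ | h)
    · exact Quot.sound (Or.inl ⟨t, ht, h⟩)
    · rcases spanning_mate_or A x with h' | h'
      · exact congrArg (Quot.mk _) (h.trans h').symm
      · exact Quot.sound (Or.inr (h.trans h'))
  · rintro ⟨x⟩
    exact ⟨Quot.mk _ x, rfl⟩

theorem rank_spanning_le (A : Set G.Edge) : (G.spanning A).rank ≤ G.rank :=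
  Nat.sub_le_sub_left (numComponents_le_spanning A) _

/-- The vertices of `G` are the components of the graph obtained by cutting all edges. -/
theorem numVertices_eq_numComponents (G : StrandedGraph.{u} n) :
    G.numVertices = (G.spanning ∅).numComponents := by
  refine congrArg (· + G.discs) (Quot.card_eq_of_retract (r := G.chordRel)
    (r' := (G.spanning ∅).compRel) (fun x => x) (fun x => x) ?_ ?_ (fun _ => rfl) (fun _ => rfl))
  · rintro x y ⟨t, ht, h⟩
    exact Quot.sound (Or.inl ⟨t, ht, h⟩)
  · rintro x y (⟨t, ht, h⟩ | h)
    · exact Quot.sound ⟨t, ht, h⟩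
    · exact congrArg (Quot.mk _) (h.trans (spanning_mate_of_notMem fun _ ha => ha.elim)).symm

theorem Joins.spanning {e : G.Edge} (h : G.Joins e) {A : Set G.Edge} (he : e ∈ A) :
    (G.spanning A).Joins (spanningEdge he) := by
  intro z hz
  have : (G.spanning A).mate z = G.mate z := spanning_mate_of_mem he hz
  rw [this]
  exact h z hz

theorem Orientable.numVertices_contract (hn : 1 ≤ n) (hG : G.Orientable) {e : G.Edge}
    (he : G.Joins e) : (G.contract e).numVertices + 1 = G.numVertices := by
  obtain ⟨d, hd⟩ := exists_mem_edge e
  have hins : e ∈ insert e (∅ : Set G.Edge) := Set.mem_insert e ∅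
  have hJ := he.spanning hins
  rw [numVertices_eq_numComponents, numVertices_eq_numComponents,
    ← spanning_cut_eq (Set.notMem_empty e), ← spanning_contract_eq hins (B := ∅),
    (hG.spanning _).numComponents_contract hn hJ]
  · symm
    refine numComponents_cut (G := G.spanning (insert e ∅)) (d := d) hd ?_
    -- without other edges, components are vertices
    intro h
    refine hJ d hd (Quot.mk_eq_of_map (fun x => x) ?_ h)
    rintro x y (⟨t, ht, h⟩ | h)
    · exact Quot.sound ⟨t, ht, h⟩
    · have h' : y = x := by
        refine h.trans ?_
        by_cases hx : x ∈ e.1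
        · exact cut_mate_of_mem (G := G.spanning (insert e ∅)) hx
        · refine (cut_mate_of_notMem (G := G.spanning (insert e ∅)) hx).trans
            (spanning_mate_of_notMem ?_)
          rintro a (rfl | ha) hxa
          · exact hx hxa
          · exact ha
      rw [h']
  · intro x
    refine iff_of_false (by simp) ?_
    rintro ⟨a, rfl | ha, hxa⟩
    · exact x.2 hxa
    · exact ha

theorem Orientable.rank_contract (hn : 1 ≤ n) (hG : G.Orientable) {e : G.Edge}
    (he : G.Joins e) : G.rank = (G.contract e).rank + 1 := by
  have h1 := hG.numVertices_contract hn he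
  have h2 := hG.numComponents_contract hn he
  have h3 := numComponents_le_numVertices (G.contract e)
  unfold rank
  omega

theorem Orientable.nullity_contract (hn : 1 ≤ n) (hG : G.Orientable) {e : G.Edge}
    (he : G.Joins e) : G.nullity = (G.contract e).nullity := by
  have h1 := hG.rank_contract hn he
  have h2 := numEdges_contract e
  unfold nullity
  omega

end StrandedGraph

/-! ### The terms of the polynomial -/

theorem zRatPow_add (a b : ℚ) : zRatPow (a + b) = zRatPow a * zRatPow b := by
  unfold zRatPow
  rw [AddMonoidAlgebra.single_mul_single, mul_one]

/-- The telescoping sum behind the choice of the coefficients of the numbers of bubbles. -/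
theorem sum_choose_telescope (n : ℕ) (α : ℕ → ℚ) {m : ℕ} (hm : 3 ≤ m) (hmn : m ≤ n) :
    ∑ k ∈ Finset.Icc 4 m,
      (((k : ℚ) - 1) * α (k - 1) - ((n : ℚ) - (k : ℚ) + 1) * α k) * (n.choose (k - 1) : ℚ) =
      3 * α 3 * (n.choose 3 : ℚ) - (m : ℚ) * α m * (n.choose m : ℚ) := by
  induction m, hm using Nat.le_induction with
  | base => simp
  | succ m hm ih =>
    have hc : (n.choose (m + 1) : ℚ) * ((m : ℚ) + 1) = (n.choose m : ℚ) * ((n : ℚ) - (m : ℚ)) := by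
      have := congrArg (Nat.cast (R := ℚ)) (Nat.choose_succ_right_eq n m)
      rwa [Nat.cast_mul, Nat.cast_mul, Nat.cast_sub (by omega), Nat.cast_succ] at this
    rw [Finset.sum_Icc_succ_top (by omega), ih (by omega)]
    rw [Nat.add_sub_cancel]
    push_cast
    linear_combination α (m + 1) * hc

namespace StrandedGraph

variable {n : ℕ} {G : StrandedGraph.{u} n}

/-- The factor by which cutting a bridge and contracting it differ. -/
noncomputable def bridgeFactor (n : ℕ) (α : ℕ → ℚ) : TPoly :=
  zRatPow (((n : ℚ) - 1) * ((n : ℚ) + 1) + (n : ℚ) * α n) * tvar .s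
    * tvar .w ^ (n * (n - 1) / 2) * tvar .q ^ n * tvar .t ^ 2

/-- The term of a spanning subgraph `G` in the polynomial of a graph of rank `r`. -/
noncomputable def term (α : ℕ → ℚ) (r : ℕ) (G : StrandedGraph.{u} n) : TPoly :=
  (tvar .x - 1) ^ (r - G.rank)
    * (tvar .y - 1) ^ G.nullity
    * zRatPow (((n : ℚ) - 1) * ((n : ℚ) + 2) / 2 * (G.numComponents : ℚ) - G.gamma α)
    * tvar .s ^ G.numBdryComponents
    * tvar .w ^ G.numBdryFaces
    * tvar .q ^ G.numBdryEdges
    * tvar .t ^ G.numHalfEdges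

theorem invariant_eq_sum_term (α : ℕ → ℚ) (G : StrandedGraph.{u} n) :
    G.invariant α = ∑ A : Finset G.Edge, term α G.rank (G.spanning ↑A) := rfl

theorem term_succ (α : ℕ → ℚ) {r : ℕ} (h : G.rank ≤ r) :
    term α (r + 1) G = (tvar .x - 1) * term α r G := by
  unfold term
  rw [Nat.succ_sub h, pow_succ]
  ring

theorem Orientable.gamma_contract (hn : 1 ≤ n) (α : ℕ → ℚ) (hG : G.Orientable) {e : G.Edge}
    (he : G.Joins e) : (G.contract e).gamma α = G.gamma α := by
  unfold gamma
  rw [← hG.numVertices_contract hn he, ← numEdges_contract e, he.numIntFaces_contract,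
    hG.numBubbles_contract he (by omega)]
  have : ∀ k ∈ Finset.Icc 4 n, (G.contract e).numBubbles k = G.numBubbles k := fun k hk =>
    hG.numBubbles_contract he (by have := (Finset.mem_Icc.1 hk).1; omega)
  rw [Finset.sum_congr rfl fun k hk => by rw [this k hk]]
  push_cast
  ring

/-- Contracting an edge that joins two vertices changes none of the exponents. -/
theorem Orientable.term_contract (hn : 1 ≤ n) (α : ℕ → ℚ) (hG : G.Orientable) {e : G.Edge}
    (he : G.Joins e) (r : ℕ) : term α (r + 1) G = term α r (G.contract e) := by
  unfold term
  rw [hG.gamma_contract hn α he, hG.nullity_contract hn he, hG.numComponents_contract hn he,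
    he.numBdryComponents_contract, he.numBdryFaces_contract, he.numBdryEdges_contract,
    numHalfEdges_contract, hG.rank_contract hn he, Nat.add_sub_add_right]

theorem Orientable.gamma_cut (hn : 3 ≤ n) (α : ℕ → ℚ) (hG : G.Orientable) {e : G.Edge}
    {d : G.PreEdge} (hd : d ∈ e.1)
    (hb : Quot.mk (G.cut e).compRel d ≠ Quot.mk (G.cut e).compRel (G.mate d)) :
    (G.cut e).gamma α = G.gamma α - ((n : ℚ) * ((n : ℚ) - 1) / 2 + (n : ℚ) * α n) := by
  have hV : (G.cut e).numVertices = G.numVertices := rfl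
  have hB : ∀ k ∈ Finset.Icc 4 n,
      (((k : ℚ) - 1) * α (k - 1) - ((n : ℚ) - (k : ℚ) + 1) * α k) * ((G.cut e).numBubbles k : ℚ) =
      (((k : ℚ) - 1) * α (k - 1) - ((n : ℚ) - (k : ℚ) + 1) * α k) * (G.numBubbles k : ℚ) +
      (((k : ℚ) - 1) * α (k - 1) - ((n : ℚ) - (k : ℚ) + 1) * α k) * (n.choose (k - 1) : ℚ) := by
    intro k hk
    obtain ⟨j, rfl⟩ : ∃ j, k = j + 1 := ⟨k - 1, by have := (Finset.mem_Icc.1 hk).1; omega⟩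
    rw [numBubbles_cut hd hb j, Nat.add_sub_cancel]
    push_cast
    ring
  have h2 : (n.choose 2 : ℚ) = (n : ℚ) * ((n : ℚ) - 1) / 2 := Nat.cast_choose_two ℚ n
  have h3 : (n.choose 3 : ℚ) * 3 = (n.choose 2 : ℚ) * ((n : ℚ) - 2) := by
    have := congrArg (Nat.cast (R := ℚ)) (Nat.choose_succ_right_eq n 2)
    rw [Nat.cast_mul, Nat.cast_mul, Nat.cast_sub (by omega)] at this
    push_cast at this
    linarith
  unfold gamma
  rw [hV, ← numEdges_cut e, hG.numIntFaces_cut hd hb, numBubbles_cut hd hb 2,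
    Finset.sum_congr rfl hB, Finset.sum_add_distrib, sum_choose_telescope n α hn le_rfl,
    Nat.choose_self]
  push_cast
  linear_combination (-2 : ℚ) * h2 + α 3 * h3

/-- A bridge joins two vertices. -/
theorem joins_of_disconnected {e : G.Edge} {d : G.PreEdge} (hd : d ∈ e.1)
    (hb : Quot.mk (G.cut e).compRel d ≠ Quot.mk (G.cut e).compRel (G.mate d)) : G.Joins e :=
  fun _ hz => ne_mate_of_mem_edge (fun x => Quot.mk G.chordRel x) hd
    (fun h => hb (compRel_cut_of_chordRel h)) hz

theorem Orientable.rank_cut (hn : 1 ≤ n) (hG : G.Orientable) {e : G.Edge}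
    {d : G.PreEdge} (hd : d ∈ e.1)
    (hb : Quot.mk (G.cut e).compRel d ≠ Quot.mk (G.cut e).compRel (G.mate d)) :
    (G.cut e).rank = (G.contract e).rank := by
  have h1 := hG.rank_contract hn (joins_of_disconnected hd hb)
  have h2 := numComponents_cut hd hb
  have hV : (G.cut e).numVertices = G.numVertices := rfl
  unfold rank at *
  omega

theorem Orientable.nullity_cut (hn : 1 ≤ n) (hG : G.Orientable) {e : G.Edge}
    {d : G.PreEdge} (hd : d ∈ e.1)
    (hb : Quot.mk (G.cut e).compRel d ≠ Quot.mk (G.cut e).compRel (G.mate d)) :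
    (G.cut e).nullity = (G.contract e).nullity := by
  have h1 := numEdges_cut e
  have h2 := numEdges_contract e
  unfold nullity
  rw [hG.rank_cut hn hd hb]
  omega

/-- Cutting a bridge instead of contracting it multiplies the term by `bridgeFactor`. -/
theorem Orientable.term_cut (hn : 3 ≤ n) (α : ℕ → ℚ) (hG : G.Orientable) {e : G.Edge}
    {d : G.PreEdge} (hd : d ∈ e.1)
    (hb : Quot.mk (G.cut e).compRel d ≠ Quot.mk (G.cut e).compRel (G.mate d)) (r : ℕ) :
    term α r (G.cut e) = bridgeFactor n α * term α r (G.contract e) := by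
  have hn1 : 1 ≤ n := by omega
  have he := joins_of_disconnected hd hb
  have hz : ((n : ℚ) - 1) * ((n : ℚ) + 2) / 2 * ((G.cut e).numComponents : ℚ) -
      (G.cut e).gamma α = (((n : ℚ) - 1) * ((n : ℚ) + 1) + (n : ℚ) * α n) +
      (((n : ℚ) - 1) * ((n : ℚ) + 2) / 2 * ((G.contract e).numComponents : ℚ) -
        (G.contract e).gamma α) := by
    rw [numComponents_cut hd hb, hG.numComponents_contract hn1 he, hG.gamma_contract hn1 α he,
      hG.gamma_cut hn α hd hb]
    push_cast
    ring
  unfold term bridgeFactor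
  rw [hz, zRatPow_add, hG.rank_cut hn1 hd hb, hG.nullity_cut hn1 hd hb,
    he.numBdryComponents_contract, he.numBdryFaces_contract, he.numBdryEdges_contract,
    numHalfEdges_contract, hG.numBdryComponents_cut hn1 hd hb, hG.numBdryFaces_cut hd hb,
    hG.numBdryEdges_cut hd hb, numHalfEdges_cut, Nat.choose_two_right]
  simp only [pow_add, pow_one]
  ring

/-! ### Sums over spanning subgraphs -/

/-- The set of edges of `G` that corresponds to a set of edges of `G ∨ e` or `G / e`. -/
def liftEdges {e : G.Edge} {E : Type*} (φ : E ≃ {a : G.Edge // a ≠ e}) (B : Finset E) :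
    Finset G.Edge :=
  B.map (φ.toEmbedding.trans (Function.Embedding.subtype _))

theorem mem_liftEdges {e : G.Edge} {E : Type*} (φ : E ≃ {a : G.Edge // a ≠ e}) (B : Finset E)
    (a : G.Edge) : a ∈ liftEdges φ B ↔ ∃ b ∈ B, (φ b).1 = a := by
  simp [liftEdges]

theorem notMem_liftEdges {e : G.Edge} {E : Type*} (φ : E ≃ {a : G.Edge // a ≠ e})
    (B : Finset E) : e ∉ liftEdges φ B := by
  rw [mem_liftEdges]
  rintro ⟨b, -, h⟩
  exact (φ b).2 h

theorem sum_finset_edge {M : Type*} [AddCommMonoid M] (e : G.Edge) (F : Finset G.Edge → M) :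
    ∑ A : Finset G.Edge, F A =
      ∑ B : Finset {a : G.Edge // a ≠ e}, F (liftEdges (Equiv.refl _) B) +
      ∑ B : Finset {a : G.Edge // a ≠ e}, F (insert e (liftEdges (Equiv.refl _) B)) := by
  have h : ∀ F : Finset G.Edge → M, ∑ A ∈ (Finset.univ.erase e).powerset, F A =
      ∑ B : Finset {a : G.Edge // a ≠ e}, F (liftEdges (Equiv.refl _) B) := by
    intro F
    symm
    refine Finset.sum_bij (fun B _ => liftEdges (Equiv.refl _) B) ?_ ?_ ?_ fun _ _ => rfl
    · intro B _
      rw [Finset.mem_powerset]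
      intro a ha
      rw [Finset.mem_erase]
      exact ⟨fun h => notMem_liftEdges _ B (h ▸ ha), Finset.mem_univ _⟩
    · intro B _ B' _ h
      exact Finset.map_injective _ h
    · intro A hA
      rw [Finset.mem_powerset] at hA
      refine ⟨A.subtype (· ≠ e), Finset.mem_univ _, ?_⟩
      ext a
      simp only [mem_liftEdges, Finset.mem_subtype, Equiv.refl_apply]
      constructor
      · rintro ⟨b, hb, rfl⟩; exact hb
      · intro ha
        exact ⟨⟨a, Finset.ne_of_mem_erase (hA ha)⟩, ha, rfl⟩
  rw [← h F, ← h fun A => F (insert e A), ← Finset.sum_powerset_insert (Finset.notMem_erase _ _),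
    Finset.insert_erase (Finset.mem_univ _), Finset.powerset_univ]

theorem liftEdges_refl_finsetCongr {e : G.Edge} {E : Type*} (φ : E ≃ {a : G.Edge // a ≠ e})
    (B : Finset E) : liftEdges (Equiv.refl _) (φ.finsetCongr B) = liftEdges φ B := by
  unfold liftEdges
  rw [Equiv.finsetCongr_apply, Finset.map_map]
  rfl

theorem sum_liftEdges {M : Type*} [AddCommMonoid M] {e : G.Edge} {E : Type*} [Fintype E]
    (φ : E ≃ {a : G.Edge // a ≠ e}) (F : Finset G.Edge → M) :
    ∑ B : Finset {a : G.Edge // a ≠ e}, F (liftEdges (Equiv.refl _) B) =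
      ∑ B : Finset E, F (liftEdges φ B) :=
  (Fintype.sum_equiv φ.finsetCongr _ _
    fun B => congrArg F (liftEdges_refl_finsetCongr φ B).symm).symm

theorem cut_spanning_eq_liftEdges {e : G.Edge} {φ : (G.cut e).Edge ≃ {a : G.Edge // a ≠ e}}
    (hφ : ∀ b, (φ b).1.1 = b.1) (B : Finset (G.cut e).Edge) :
    (G.cut e).spanning ↑B = G.spanning ↑(liftEdges φ B) := by
  refine cut_spanning_eq (notMem_liftEdges φ B) fun x => ?_
  constructor
  · rintro ⟨b, hb, hx⟩
    exact ⟨(φ b).1, (mem_liftEdges φ B _).2 ⟨b, hb, rfl⟩, by rw [hφ]; exact hx⟩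
  · rintro ⟨a, ha, hx⟩
    obtain ⟨b, hb, rfl⟩ := (mem_liftEdges φ B _).1 ha
    exact ⟨b, hb, by rw [hφ] at hx; exact hx⟩

theorem contract_spanning_eq_liftEdges {e : G.Edge}
    {φ : (G.contract e).Edge ≃ {a : G.Edge // a ≠ e}}
    (hφ : ∀ b, (φ b).1.1 = b.1.map Subtype.val) (B : Finset (G.contract e).Edge) :
    (G.spanning (insert e ↑(liftEdges φ B))).contract (spanningEdge (Set.mem_insert e _)) =
      (G.contract e).spanning ↑B := by
  refine spanning_contract_eq (Set.mem_insert e _) fun x => ?_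
  have hmem : ∀ b : (G.contract e).Edge, x ∈ b.1 ↔ x.1 ∈ (φ b).1.1 := by
    intro b
    rw [hφ]
    constructor
    · intro h; exact Sym2.mem_map.2 ⟨x, h, rfl⟩
    · intro h
      obtain ⟨y, hy, hyx⟩ := Sym2.mem_map.1 h
      have hyx' : y = x := Subtype.ext hyx
      exact hyx' ▸ hy
  constructor
  · rintro ⟨b, hb, hx⟩
    exact ⟨(φ b).1, Or.inr ((mem_liftEdges φ B _).2 ⟨b, hb, rfl⟩), (hmem b).1 hx⟩
  · rintro ⟨a, rfl | ha, hx⟩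
    · exact absurd hx x.2
    · obtain ⟨b, hb, rfl⟩ := (mem_liftEdges φ B _).1 ha
      exact ⟨b, hb, (hmem b).2 hx⟩

/-- The spanning subgraphs of `G` that contain an edge joining two vertices contribute the
polynomial of the contraction. -/
theorem Orientable.sum_insert_eq_invariant_contract (hn : 1 ≤ n) (α : ℕ → ℚ)
    (hG : G.Orientable) {e : G.Edge} (he : G.Joins e) :
    ∑ B : Finset {a : G.Edge // a ≠ e},
      term α G.rank (G.spanning ↑(insert e (liftEdges (Equiv.refl _) B))) =
      (G.contract e).invariant α := by
  obtain ⟨φ, hφ⟩ := exists_contract_edge_equiv e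
  rw [sum_liftEdges φ fun A => term α G.rank (G.spanning ↑(insert e A)), invariant_eq_sum_term]
  refine Finset.sum_congr rfl fun B _ => ?_
  rw [hG.rank_contract hn he, ← contract_spanning_eq_liftEdges hφ B, Finset.coe_insert]
  exact (hG.spanning _).term_contract hn α (he.spanning (Set.mem_insert e _)) _

theorem rank_spanning_liftEdges_le {e : G.Edge} (B : Finset {a : G.Edge // a ≠ e}) :
    (G.spanning ↑(liftEdges (Equiv.refl _) B)).rank ≤ (G.cut e).rank := by
  obtain ⟨φ, hφ⟩ := exists_cut_edge_equiv e
  obtain ⟨B', rfl⟩ := φ.finsetCongr.surjective B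
  have h := rank_spanning_le (G := G.cut e) (↑B' : Set (G.cut e).Edge)
  rw [cut_spanning_eq_liftEdges hφ] at h
  rw [liftEdges_refl_finsetCongr]
  exact h

theorem invariant_cut_eq_sum (α : ℕ → ℚ) (e : G.Edge) :
    (G.cut e).invariant α =
      ∑ B : Finset {a : G.Edge // a ≠ e},
        term α (G.cut e).rank (G.spanning ↑(liftEdges (Equiv.refl _) B)) := by
  obtain ⟨φ, hφ⟩ := exists_cut_edge_equiv e
  rw [sum_liftEdges φ fun A => term α (G.cut e).rank (G.spanning ↑A), invariant_eq_sum_term]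
  refine Finset.sum_congr rfl fun B _ => ?_
  rw [cut_spanning_eq_liftEdges hφ]

/-- A bridge remains a bridge in the spanning subgraphs that contain it. -/
theorem compRel_cut_of_spanning {A : Set G.Edge} {e : G.Edge} (he : e ∈ A) {x y : G.PreEdge}
    (h : Quot.mk ((G.spanning A).cut (spanningEdge he)).compRel x =
      Quot.mk ((G.spanning A).cut (spanningEdge he)).compRel y) :
    Quot.mk (G.cut e).compRel x = Quot.mk (G.cut e).compRel y := by
  refine Quot.mk_eq_of_map (X := G.PreEdge) (Y := G.PreEdge)
    (r := ((G.spanning A).cut (spanningEdge he)).compRel) (r' := (G.cut e).compRel)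
    (fun x => x) ?_ h
  rintro a b (⟨t, ht, h⟩ | h)
  · exact Quot.sound (Or.inl ⟨t, ht, h⟩)
  · have hab : b = a ∨ b = (G.cut e).mate a := by
      by_cases ha : a ∈ e.1
      · exact Or.inl (h.trans (cut_mate_of_mem (G := G.spanning A) ha))
      · have h' := h.trans (cut_mate_of_notMem (G := G.spanning A) (e := spanningEdge he) ha)
        rcases spanning_mate_or A a with h1 | h1
        · exact Or.inl (h'.trans h1)
        · exact Or.inr (h'.trans (h1.trans (cut_mate_of_notMem ha).symm))
    rcases hab with rfl | hab
    · rfl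
    · exact Quot.sound (Or.inr hab)

theorem Orientable.invariant_cut_of_bridge (hn : 3 ≤ n) (α : ℕ → ℚ) (hG : G.Orientable)
    {e : G.Edge} {d : G.PreEdge} (hd : d ∈ e.1)
    (hb : Quot.mk (G.cut e).compRel d ≠ Quot.mk (G.cut e).compRel (G.mate d)) :
    (G.cut e).invariant α = bridgeFactor n α * (G.contract e).invariant α := by
  obtain ⟨φ, hφ⟩ := exists_contract_edge_equiv e
  rw [invariant_cut_eq_sum, sum_liftEdges φ fun A => term α (G.cut e).rank (G.spanning ↑A),
    invariant_eq_sum_term, Finset.mul_sum, hG.rank_cut (by omega) hd hb]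
  refine Finset.sum_congr rfl fun B _ => ?_
  have hmem : e ∈ insert e (↑(liftEdges φ B) : Set G.Edge) := Set.mem_insert e _
  rw [← contract_spanning_eq_liftEdges hφ B]
  refine (congrArg (term α _) (spanning_cut_eq (notMem_liftEdges φ B)).symm).trans ?_
  refine (hG.spanning _).term_cut hn α (d := d) hd (fun h => hb ?_) _
  have hm : (G.spanning (insert e ↑(liftEdges φ B))).mate d = G.mate d :=
    spanning_mate_of_mem hmem hd
  rw [hm] at h
  exact compRel_cut_of_spanning hmem h

end StrandedGraph

theorem eq_add_one_mul_of_eq {R : Type*} [CommRing R] {a b c p q : R} (h : a = p * b + c)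
    (h' : b = q * c) : a = (p * q + 1) * c := by
  rw [h, h']
  ring

open StrandedGraph in
theorem theorem4p4 (n : ℕ) (hn : 3 ≤ n) (α : ℕ → ℚ) (hα : ∀ k, 3 ≤ k → k ≤ n → 0 < α k)
    (W : WColoredGraph.{u} n) (G : StrandedGraph.{u} n) (hG : W.IsRepresentative G)
    (e : G.Edge) :
    (G.IsRegular e →
      G.invariant α = (G.cut e).invariant α + (G.contract e).invariant α) ∧
    (G.IsBridge e →
      (G.cut e).invariant α =
          zRatPow (((n : ℚ) - 1) * ((n : ℚ) + 1) + (n : ℚ) * α n) * tvar .s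
            * tvar .w ^ (n * (n - 1) / 2) * tvar .q ^ n * tvar .t ^ 2
            * (G.contract e).invariant α ∧
      G.invariant α =
          ((tvar .x - 1) *
            (zRatPow (((n : ℚ) - 1) * ((n : ℚ) + 1) + (n : ℚ) * α n) * tvar .s
              * tvar .w ^ (n * (n - 1) / 2) * tvar .q ^ n * tvar .t ^ 2) + 1)
            * (G.contract e).invariant α) := by
  have hO := hG.orientable
  have hn1 : 1 ≤ n := by omega
  obtain ⟨d, hd⟩ := exists_mem_edge e
  constructor
  · rintro ⟨hl, hb⟩
    rw [isBridge_iff hd, not_not] at hb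
    have hr : (G.cut e).rank = G.rank :=
      congrArg (G.numVertices - ·) (numComponents_cut_of_connected hd hb)
    rw [invariant_eq_sum_term, sum_finset_edge e,
      hO.sum_insert_eq_invariant_contract hn1 α (joins_of_not_isLoop hl),
      invariant_cut_eq_sum, hr]
  · intro hb
    rw [isBridge_iff hd] at hb
    have he := joins_of_disconnected hd hb
    have h1 := hO.invariant_cut_of_bridge hn α hd hb
    refine ⟨h1, ?_⟩
    have hr : G.rank = (G.cut e).rank + 1 := by
      rw [hO.rank_cut hn1 hd hb, hO.rank_contract hn1 he]
    have h2 : ∑ B : Finset {a : G.Edge // a ≠ e},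
        term α G.rank (G.spanning ↑(liftEdges (Equiv.refl _) B)) =
        (tvar .x - 1) * (G.cut e).invariant α := by
      rw [invariant_cut_eq_sum, Finset.mul_sum]
      refine Finset.sum_congr rfl fun B _ => ?_
      rw [hr, term_succ α (rank_spanning_liftEdges_le B)]
    have h3 : G.invariant α =
        (tvar .x - 1) * (G.cut e).invariant α + (G.contract e).invariant α := by
      rw [invariant_eq_sum_term, sum_finset_edge e, h2,
        hO.sum_insert_eq_invariant_contract hn1 α he]
    exact eq_add_one_mul_of_eq h3 h1
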